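/- Let $\mathbb{A}$ be a finite-dimensional commutative associative algebra with unit over $\mathbb{C}$ (with its unique Hausdorff vector space topology), and let $f_1,\dots,f_m:\mathbb{A}\to\mathbb{C}$ be all its multiplicative linear functionals (unital $\mathbb{C}$-algebra homomorphisms), i.e. the linear functionals with $f_u(1)=1$ whose kernels are the maximal ideals of $\mathbb{A}$. Let $e_1=1,e_2,e_3\in\mathbb{A}$ be linearly independent over $\mathbb{R}$, let $E_3=\{xe_1+ye_2+ze_3:\ x,y,z\in\mathbb{R}\}$, and assume that $f_u(E_3)=\mathbb{C}$ for all $u=1,\dots,m$. For each $u$ let $L_u\subset\mathbb{R}^3$ be the straight line of all $(x,y,z)$ with $f_u(xe_1+ye_2+ze_3)=0$, i.e. with $x+y\,\mathrm{Re}\,f_u(e_2)+z\,\mathrm{Re}\,f_u(e_3)=0$ and $y\,\mathrm{Im}\,f_u(e_2)+z\,\mathrm{Im}\,f_u(e_3)=0$. For $S\subset E_3$ open in $E_3$, a function $\Phi:S\to\mathbb{A}$ is called monogenic in $S$ if it is continuous and for every $\zeta\in S$ there is an element $\Phi'(\zeta)\in\mathbb{A}$ with $\lim_{\varepsilon\to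 0+}\left(\Phi(\zeta+\varepsilon h)-\Phi(\zeta)\right)\varepsilon^{-1}=h\,\Phi'(\zeta)$ for all $h\in E_3$. Let $\Omega\subset\mathbb{R}^3$ be a domain (a non-empty connected open set) that is convex in the direction of each of the lines $L_1,\dots,L_m$ (with any two points whose difference lies in $L_u$ it contains the segment joining them). Put $\Omega_\zeta=\{xe_1+ye_2+ze_3:\ (x,y,z)\in\Omega\}$, $D_u=f_u(\Omega_\zeta)$, and $\Pi_\zeta=\{\zeta\in E_3:\ f_u(\zeta)\in D_u \text{ for all } u=1,\dots,m\}$. Then $\Pi_\zeta$ is open in $E_3$ and contains $\Omega_\zeta$, and every monogenic function $\Phi:\Omega_\zeta\to\mathbb{A}$ can be continued to a monogenic function in $\Pi_\zeta$, i.e. there is a monogenic function $\Psi:\Pi_\zeta\to\mathbb{A}$ with $\Psi=\Phi$ on $\Omega_\zeta$. -/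

import Mathlib

open Set Filter Topology

namespace MonogenicExtension

variable {A : Type*} [CommRing A] [Algebra ℂ A]

/-- The point `ζ = x e₁ + y e₂ + z e₃` of the algebra, where `e₁ = 1` and `p = (x, y, z)`. -/
def point (e₂ e₃ : A) (p : EuclideanSpace ℝ (Fin 3)) : A :=
  p 0 • (1 : A) + p 1 • e₂ + p 2 • e₃

/-- `E₃`, the linear span over `ℝ` of the vectors `e₁ = 1`, `e₂`, `e₃`. -/
def E3 (e₂ e₃ : A) : Submodule ℝ A :=
  Submodule.span ℝ {1, e₂, e₃}

/-- `Ω_ζ = {x e₁ + y e₂ + z e₃ : (x, y, z) ∈ Ω}`. -/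
def domainImage (e₂ e₃ : A) (Ω : Set (EuclideanSpace ℝ (Fin 3))) : Set A :=
  point e₂ e₃ '' Ω

/-- The straight line `L_u` in `ℝ³` that belongs to the multiplicative functional `f = f_u`:
with `a = f e₂` and `b = f e₃` it is given by the two equations
`x + y Re a + z Re b = 0` and `y Im a + z Im b = 0`. -/
def line (e₂ e₃ : A) (f : A →ₐ[ℂ] ℂ) : Set (EuclideanSpace ℝ (Fin 3)) :=
  {p | p 0 + p 1 * (f e₂).re + p 2 * (f e₃).re = 0 ∧
    p 1 * (f e₂).im + p 2 * (f e₃).im = 0}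

/-- `Ω` is convex in the direction of the line `L` (through the origin): with any two points whose
difference is parallel to `L`, it contains the segment that joins them. -/
def ConvexInDirection (L Ω : Set (EuclideanSpace ℝ (Fin 3))) : Prop :=
  ∀ p ∈ Ω, ∀ q ∈ Ω, q - p ∈ L → segment ℝ p q ⊆ Ω

/-- `Π_ζ = {ζ ∈ E₃ : f_u(ζ) ∈ D_u for all u}`, where `D_u = f_u(Ω_ζ)` and `f_u` runs through the
multiplicative functionals of the algebra. -/
def extendedDomain (e₂ e₃ : A) (Ω : Set (EuclideanSpace ℝ (Fin 3))) : Set A :=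
  {ζ | ζ ∈ E3 e₂ e₃ ∧ ∀ f : A →ₐ[ℂ] ℂ, f ζ ∈ f '' domainImage e₂ e₃ Ω}

/-- `Φ` has the Gateaux derivative `d` at the point `ζ`: for every `h ∈ E₃`,
`(Φ (ζ + ε h) - Φ ζ) ε⁻¹ → h d` as `ε → 0+`. -/
def HasGateauxDerivAt [TopologicalSpace A] (e₂ e₃ : A) (Φ : A → A) (d ζ : A) : Prop :=
  ∀ h ∈ E3 e₂ e₃,
    Tendsto (fun ε : ℝ => ε⁻¹ • (Φ (ζ + ε • h) - Φ ζ)) (𝓝[>] 0) (𝓝 (h * d))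

/-- `Φ` is monogenic in `S`, a relatively open subset of `E₃`: it is continuous on `S` and
differentiable in the sense of Gateaux at every point of `S`. As `S` is relatively open in `E₃`,
only the values of `Φ` on `S` matter. -/
def MonogenicOn [TopologicalSpace A] (e₂ e₃ : A) (Φ : A → A) (S : Set A) : Prop :=
  ContinuousOn Φ S ∧ ∀ ζ ∈ S, ∃ d : A, HasGateauxDerivAt e₂ e₃ Φ d ζ

end MonogenicExtension

/-! The values of `Φ` are pushed down a chain of ideals from `A` to `0`. If an ideal `J` covers
`J'`, then `J / J'` is one-dimensional and `A` acts on it by a character `f`. Let `φ` be a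
functional on `J` with kernel `J'`, and let `Φ` take values in `J`. The derivative of `φ ∘ Φ` in the
direction `h` is `f h * φ (Φ' ζ)`, so it vanishes along `L_f`. By the convexity of `Ω`, `φ ∘ Φ = G ∘
f` with one function `G` on `f(Ω_ζ)`, and `G` is holomorphic.

Choose `b ∈ J` with `φ b = 1`, killed by a power of `ker f`. The finite Taylor sum `T ζ = ∑ G⁽ᵏ⁾(f
ζ) / k! * (ζ - f ζ)^k * b` is monogenic wherever `f ζ` lies in `f(Ω_ζ)`, hence on `Π_ζ`, and `φ ∘ T
= φ ∘ Φ` on `Ω_ζ`. So `Φ - T` takes values in `J'`, and induction on the ideal extends it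
(`exists_monogenicOn_extendedDomain`).

Gateaux differentiability provides only directional derivatives of `G`, neither continuous nor a
total differential. Holomorphy therefore rests on the Looman–Menchoff theorem,
`LoomanMenchoff.differentiableOn_of_hasDerivAt_lines`. By Baire, the set of non-holomorphy would
have a portion on which `G` is uniformly Lipschitz along both axes. Near that portion, integrals
over rectangle boundaries are bounded by the area of the rectangle outside the bad set. Bisection
improves the bound to `0`, and Morera's theorem gives a contradiction. -/

namespace LoomanMenchoff

open MeasureTheory
open scoped NNReal

/-! ### Increments of a function of one variable that is Lipschitz at the points of a closed set. -/

/-- Almost every point of a subset of the line is an accumulation point of it. -/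
theorem ae_uniqueDiffWithinAt (K : Set ℝ) :
    ∀ᵐ x ∂volume, x ∈ K → UniqueDiffWithinAt ℝ K x := by
  -- Only countably many points of `K` are isolated in it from the right.
  have hc := (countable_setOfPred_isolated_right_within (s := K)).measure_zero volume
  filter_upwards [measure_eq_zero_iff_ae_notMem.1 hc] with x hx hxK
  rw [uniqueDiffWithinAt_iff_accPt, accPt_principal_iff_nhdsWithin]
  have h1 : (𝓝[K ∩ Ioi x] x).NeBot := ⟨fun h => hx ⟨hxK, h⟩⟩
  exact h1.mono (nhdsWithin_mono _ fun y hy => ⟨hy.1, ne_of_gt hy.2⟩)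

/-- Extend `φ` from `K` to an `N`-Lipschitz `ψ` and apply the fundamental theorem of calculus to
`ψ`. Its derivative is `p` almost everywhere on `K` and at most `N` in modulus off `K`. The constant
is `5 = 1 + 2 + 2`: the integral off `K`, and the discrepancy of `φ` and `ψ` at each endpoint. -/
theorem real_increment_estimate {a b : ℝ} (hab : a ≤ b) {K : Set ℝ} (hK : IsClosed K)
    (hKne : K.Nonempty) (hKab : K ⊆ Icc a b) {φ p : ℝ → ℝ} {N : ℝ≥0}
    (hlip : ∀ x ∈ K, ∀ y ∈ Icc a b, |φ y - φ x| ≤ N * |y - x|)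
    (hp : ∀ x ∈ K, HasDerivWithinAt φ (p x) K x) :
    IntegrableOn p K ∧ |φ b - φ a - ∫ x in K, p x| ≤ 5 * N * volume.real (Icc a b \ K) := by
  have hKm : MeasurableSet K := hK.measurableSet
  have hfin : volume (Icc a b \ K) ≠ ⊤ :=
    ne_top_of_le_ne_top (by simp) (measure_mono (sdiff_subset : Icc a b \ K ⊆ Icc a b))
  obtain ⟨ψ, hψ, hEq⟩ : ∃ ψ : ℝ → ℝ, LipschitzWith N ψ ∧ EqOn φ ψ K :=
    LipschitzOnWith.extend_real (LipschitzOnWith.of_dist_le_mul fun x hx y hy => by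
      simpa [Real.dist_eq] using hlip y hy x (hKab hx))
  have hac : AbsolutelyContinuousOnInterval ψ a b :=
    (hψ.lipschitzOnWith (s := uIcc a b)).absolutelyContinuousOnInterval
  have hint : IntegrableOn (deriv ψ) (Icc a b) :=
    (intervalIntegrable_iff_integrableOn_Icc_of_le hab).1 hac.intervalIntegrable_deriv
  have hftc : ψ b - ψ a = (∫ x in K, deriv ψ x) + ∫ x in Icc a b \ K, deriv ψ x := by
    rw [← hac.integral_deriv_eq_sub, intervalIntegral.integral_of_le hab,
      ← integral_Icc_eq_integral_Ioc, ← integral_inter_add_sdiff hKm hint,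
      inter_eq_self_of_subset_right hKab]
  have hae : deriv ψ =ᵐ[volume.restrict K] p := by
    rw [EventuallyEq, ae_restrict_iff' hKm]
    filter_upwards [ae_uniqueDiffWithinAt K, hψ.ae_differentiableAt] with x hu hd hx
    exact (hu hx).eq_deriv _ hd.hasDerivAt.hasDerivWithinAt
      ((hp x hx).congr (fun y hy => (hEq hy).symm) (hEq hx).symm)
  refine ⟨(hint.mono_set hKab).congr hae, ?_⟩
  rw [← integral_congr_ae hae]
  have hrest : |∫ x in Icc a b \ K, deriv ψ x| ≤ N * volume.real (Icc a b \ K) :=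
    norm_setIntegral_le_of_norm_le_const hfin.lt_top fun x _ => norm_deriv_le_of_lipschitz hψ
  have hKc : IsCompact K := isCompact_Icc.of_isClosed_subset hK hKab
  -- Both functions agree at `sSup K`, and the gap from there to `b` lies outside `K`; each of them
  -- moves by at most `N` times its length.
  have hb : |φ b - ψ b| ≤ 2 * N * volume.real (Icc a b \ K) := by
    have hm := hKc.sSup_mem hKne
    have hle : b - sSup K ≤ volume.real (Icc a b \ K) := by
      rw [← Real.volume_real_Ioc_of_le (hKab hm).2]
      refine measureReal_mono (fun y hy => ⟨⟨(hKab hm).1.trans hy.1.le, hy.2⟩, fun hyK => ?_⟩) hfin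
      exact absurd (le_csSup hKc.bddAbove hyK) (not_le.2 hy.1)
    have h1 := hlip _ hm b (right_mem_Icc.2 hab)
    have h2 := hψ.dist_le_mul b (sSup K)
    rw [Real.dist_eq, Real.dist_eq] at h2
    rw [abs_of_nonneg (sub_nonneg.2 (hKab hm).2)] at h1 h2
    have h3 : φ b - ψ b = (φ b - φ (sSup K)) - (ψ b - ψ (sSup K)) := by rw [hEq hm]; ring
    rw [h3]
    have := mul_le_mul_of_nonneg_left hle N.2
    refine (abs_sub _ _).trans ?_
    change (N : ℝ) * _ ≤ N * _ at this
    linarith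
  have ha : |φ a - ψ a| ≤ 2 * N * volume.real (Icc a b \ K) := by
    have hm := hKc.sInf_mem hKne
    have hle : sInf K - a ≤ volume.real (Icc a b \ K) := by
      rw [← Real.volume_real_Ico_of_le (hKab hm).1]
      refine measureReal_mono (fun y hy => ⟨⟨hy.1, hy.2.le.trans (hKab hm).2⟩, fun hyK => ?_⟩) hfin
      exact absurd (csInf_le hKc.bddBelow hyK) (not_le.2 hy.2)
    have h1 := hlip _ hm a (left_mem_Icc.2 hab)
    have h2 := hψ.dist_le_mul a (sInf K)
    rw [Real.dist_eq, Real.dist_eq] at h2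
    rw [abs_sub_comm a, abs_of_nonneg (sub_nonneg.2 (hKab hm).1)] at h1 h2
    have h3 : φ a - ψ a = (φ a - φ (sInf K)) - (ψ a - ψ (sInf K)) := by rw [hEq hm]; ring
    rw [h3]
    have := mul_le_mul_of_nonneg_left hle N.2
    refine (abs_sub _ _).trans ?_
    change (N : ℝ) * _ ≤ N * _ at this
    linarith
  have hdec : φ b - φ a - ∫ x in K, deriv ψ x
      = (φ b - ψ b) - (φ a - ψ a) + ∫ x in Icc a b \ K, deriv ψ x := by linarith
  rw [hdec]
  have h1 := abs_add_le ((φ b - ψ b) - (φ a - ψ a)) (∫ x in Icc a b \ K, deriv ψ x)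
  have h2 := abs_sub (φ b - ψ b) (φ a - ψ a)
  linarith

theorem increment_estimate {a b : ℝ} (hab : a ≤ b) {K : Set ℝ} (hK : IsClosed K)
    (hKne : K.Nonempty) (hKab : K ⊆ Icc a b) {φ p : ℝ → ℂ} {N : ℝ≥0}
    (hlip : ∀ x ∈ K, ∀ y ∈ Icc a b, ‖φ y - φ x‖ ≤ N * |y - x|)
    (hp : ∀ x ∈ K, HasDerivWithinAt φ (p x) K x) :
    ‖φ b - φ a - ∫ x in K, p x‖ ≤ 10 * N * volume.real (Icc a b \ K) := by
  obtain ⟨i1, h1⟩ := real_increment_estimate (φ := fun x => (φ x).re) (p := fun x => (p x).re)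
    hab hK hKne hKab
    (fun x hx y hy => (by simpa using Complex.abs_re_le_norm (φ y - φ x)
      : |(φ y).re - (φ x).re| ≤ _).trans (hlip x hx y hy))
    (fun x hx => Complex.reCLM.hasFDerivAt.comp_hasDerivWithinAt x (hp x hx))
  obtain ⟨i2, h2⟩ := real_increment_estimate (φ := fun x => (φ x).im) (p := fun x => (p x).im)
    hab hK hKne hKab
    (fun x hx y hy => (by simpa using Complex.abs_im_le_norm (φ y - φ x)
      : |(φ y).im - (φ x).im| ≤ _).trans (hlip x hx y hy))
    (fun x hx => Complex.imCLM.hasFDerivAt.comp_hasDerivWithinAt x (hp x hx))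
  have hi : IntegrableOn p K := by
    have := (i1.ofReal (𝕜 := ℂ)).add ((i2.ofReal (𝕜 := ℂ)).const_mul Complex.I)
    refine this.congr (Eventually.of_forall fun x => ?_)
    simp [mul_comm Complex.I, Complex.re_add_im]
  refine (Complex.norm_le_abs_re_add_abs_im _).trans ?_
  have e1 : (∫ x in K, p x).re = ∫ x in K, (p x).re := (integral_re hi).symm
  have e2 : (∫ x in K, p x).im = ∫ x in K, (p x).im := (integral_im hi).symm
  simp only [Complex.sub_re, Complex.sub_im, e1, e2]
  linarith

end LoomanMenchoff

/-! ### Integration of the one-variable estimates over slices of the plane. -/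

namespace LoomanMenchoff

open MeasureTheory
open scoped NNReal

theorem integrable_and_integral_slices {s : Set (ℝ × ℝ)} (hs : MeasurableSet s) {P : ℝ × ℝ → ℂ}
    (hP : IntegrableOn P s) :
    Integrable (fun y => ∫ x in (fun x => (x, y)) ⁻¹' s, P (x, y)) ∧
      ∫ z in s, P z = ∫ y, ∫ x in (fun x => (x, y)) ⁻¹' s, P (x, y) := by
  have h1 : Integrable (s.indicator P) ((volume : Measure ℝ).prod volume) :=
    (integrable_indicator_iff hs).2 hP
  have h2 : ∀ y, ∫ x in (fun x => (x, y)) ⁻¹' s, P (x, y) = ∫ x, s.indicator P (x, y) := fun y => by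
    rw [← integral_indicator (measurable_prodMk_right hs)]; rfl
  simp only [h2]
  exact ⟨h1.integral_prod_right, by
    rw [← integral_indicator hs, Measure.volume_eq_prod, integral_prod_symm _ h1]⟩

theorem integrable_and_integral_measureReal_slices {s : Set (ℝ × ℝ)} (hs : MeasurableSet s)
    (hfin : volume s ≠ ⊤) :
    Integrable (fun y => volume.real ((fun x => (x, y)) ⁻¹' s)) ∧
      volume.real s = ∫ y, volume.real ((fun x => (x, y)) ⁻¹' s) := by
  have h1 : Integrable (s.indicator (1 : ℝ × ℝ → ℝ)) ((volume : Measure ℝ).prod volume) :=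
    (integrable_indicator_iff hs).2 (integrableOn_const hfin)
  have h2 : ∀ y, volume.real ((fun x => (x, y)) ⁻¹' s) = ∫ x, s.indicator (1 : ℝ × ℝ → ℝ) (x, y) :=
    fun y => by
      rw [← integral_indicator_one (measurable_prodMk_right hs)]; rfl
  simp only [h2]
  exact ⟨h1.integral_prod_right, by
    rw [← integral_indicator_one hs, Measure.volume_eq_prod, integral_prod_symm _ h1]⟩

/-- If `w` is Lipschitz along the lines of both directions at the points of the closed set `K`, then
the increments of `w` across the smallest rectangle around `K` are controlled by its derivative on
`K` and by the measure of the complement of `K`. -/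
theorem horizontal_estimate {a₁ b₁ a₂ b₂ α₁ β₁ α₂ β₂ : ℝ} (hab₁ : a₁ < b₁)
    (ha₁ : a₁ ≤ α₁) (hb₁ : β₁ ≤ b₁) (ha₂ : a₂ ≤ α₂) (hαβ₂ : α₂ ≤ β₂) (hb₂ : β₂ ≤ b₂)
    {K : Set (ℝ × ℝ)} (hK : IsClosed K) (hKR : K ⊆ Icc α₁ β₁ ×ˢ Icc α₂ β₂)
    {ya yb : ℝ} (hya : (α₁, ya) ∈ K) (hyb : (β₁, yb) ∈ K)
    {w : ℝ → ℝ → ℂ} {P : ℝ × ℝ → ℂ} {N : ℝ≥0}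
    (hlip₁ : ∀ z ∈ K, ∀ x ∈ Icc a₁ b₁, ‖w x z.2 - w z.1 z.2‖ ≤ N * |x - z.1|)
    (hlip₂ : ∀ z ∈ K, ∀ y ∈ Icc a₂ b₂, ‖w z.1 y - w z.1 z.2‖ ≤ N * |y - z.2|)
    (hp : ∀ z ∈ K, HasDerivAt (fun x => w x z.2) (P z) z.1)
    (hP : IntegrableOn P K)
    (hw : IntervalIntegrable (fun y => w β₁ y - w α₁ y) volume α₂ β₂) :
    ‖(∫ y in α₂..β₂, (w β₁ y - w α₁ y)) - ∫ z in K, P z‖ ≤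
      N * (10 + 3 * ((b₂ - a₂) / (b₁ - a₁))) *
        volume.real ((Icc a₁ b₁ ×ˢ Icc a₂ b₂) \ K) := by
  have hKm := hK.measurableSet
  have hQm : MeasurableSet ((Icc a₁ b₁ ×ˢ Icc a₂ b₂) \ K) :=
    (measurableSet_Icc.prod measurableSet_Icc).diff hKm
  have hfin : volume ((Icc a₁ b₁ ×ˢ Icc a₂ b₂) \ K) ≠ ⊤ :=
    ne_top_of_le_ne_top (isCompact_Icc.prod isCompact_Icc).measure_lt_top.ne
      (measure_mono sdiff_subset)
  obtain ⟨iJ, eJ⟩ := integrable_and_integral_slices hKm hP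
  obtain ⟨im, em⟩ := integrable_and_integral_measureReal_slices hQm hfin
  set C : ℝ := N * (10 + 3 * ((b₂ - a₂) / (b₁ - a₁))) with hC
  have hα₁ : α₁ ≤ β₁ := (hKR hya).1.2
  have hpos : 0 < b₁ - a₁ := sub_pos.2 hab₁
  have hpt : ∀ y ∈ Icc α₂ β₂,
      ‖(w β₁ y - w α₁ y) - ∫ x in (fun x => (x, y)) ⁻¹' K, P (x, y)‖ ≤
        C * volume.real ((fun x => (x, y)) ⁻¹' ((Icc a₁ b₁ ×ˢ Icc a₂ b₂) \ K)) := by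
    intro y hy
    have hy' : y ∈ Icc a₂ b₂ := ⟨ha₂.trans hy.1, hy.2.trans hb₂⟩
    have hsl : (fun x => (x, y)) ⁻¹' ((Icc a₁ b₁ ×ˢ Icc a₂ b₂) \ K) =
        Icc a₁ b₁ \ (fun x => (x, y)) ⁻¹' K := by
      ext x; simp [hy'.1, hy'.2]
    rw [hsl]
    have hratio : 0 ≤ (b₂ - a₂) / (b₁ - a₁) := div_nonneg (by linarith [hy'.1, hy'.2]) hpos.le
    rcases ((fun x => (x, y)) ⁻¹' K).eq_empty_or_nonempty with hem | hne
    -- The line at height `y` misses `K`, so the whole length `b₁ - a₁` is available as a bound. The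
    -- two ends are joined through `(β₁, yb)`, `(α₁, yb)` and `(α₁, ya)`: one horizontal move and
    -- three vertical ones, whence the term `3 * ((b₂ - a₂) / (b₁ - a₁))`.
    · rw [hem, Measure.restrict_empty, integral_zero_measure, sub_zero, sdiff_empty,
        Real.volume_real_Icc_of_le hab₁.le]
      have ra := (hKR hya).2
      have rb := (hKR hyb).2
      have e : w β₁ y - w α₁ y = (w β₁ y - w β₁ yb) - (w α₁ yb - w β₁ yb)
          + (w α₁ yb - w α₁ ya) - (w α₁ y - w α₁ ya) := by ring
      have k1 := hlip₂ _ hyb y hy'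
      have k2 := hlip₁ _ hyb α₁ ⟨ha₁, hα₁.trans hb₁⟩
      have k3 := hlip₂ _ hya yb ⟨ha₂.trans rb.1, rb.2.trans hb₂⟩
      have k4 := hlip₂ _ hya y hy'
      simp only at k1 k2 k3 k4 ra rb
      have l1 : |y - yb| ≤ b₂ - a₂ := by
        rw [abs_le]; constructor <;> linarith [hy'.1, hy'.2, ra.1, ra.2, rb.1, rb.2]
      have l2 : |α₁ - β₁| ≤ b₁ - a₁ := by
        rw [abs_le]; constructor <;> linarith
      have l3 : |yb - ya| ≤ b₂ - a₂ := by
        rw [abs_le]; constructor <;> linarith [hy'.1, hy'.2, ra.1, ra.2, rb.1, rb.2]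
      have l4 : |y - ya| ≤ b₂ - a₂ := by
        rw [abs_le]; constructor <;> linarith [hy'.1, hy'.2, ra.1, ra.2, rb.1, rb.2]
      have hN : (0 : ℝ) ≤ N := N.2
      have m1 := k1.trans (mul_le_mul_of_nonneg_left l1 hN)
      have m2 := k2.trans (mul_le_mul_of_nonneg_left l2 hN)
      have m3 := k3.trans (mul_le_mul_of_nonneg_left l3 hN)
      have m4 := k4.trans (mul_le_mul_of_nonneg_left l4 hN)
      have htri : ‖w β₁ y - w α₁ y‖ ≤ ‖w β₁ y - w β₁ yb‖ + ‖w α₁ yb - w β₁ yb‖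
          + ‖w α₁ yb - w α₁ ya‖ + ‖w α₁ y - w α₁ ya‖ := by
        rw [e]
        refine (norm_sub_le _ _).trans (add_le_add_left ?_ _)
        refine (norm_add_le _ _).trans (add_le_add_left ?_ _)
        exact norm_sub_le _ _
      have hCe : C * (b₁ - a₁) = N * (10 * (b₁ - a₁) + 3 * (b₂ - a₂)) := by
        rw [hC]; field_simp
      rw [hCe]
      nlinarith [mul_nonneg hN hpos.le]
    · have hsub : (fun x => (x, y)) ⁻¹' K ⊆ Icc α₁ β₁ := fun x hx => (hKR hx).1
      have hin := increment_estimate hα₁ (hK.preimage (by fun_prop)) hne hsub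
        (φ := fun x => w x y) (p := fun x => P (x, y)) (N := N)
        (fun x hx x' hx' => hlip₁ _ hx x' ⟨ha₁.trans hx'.1, hx'.2.trans hb₁⟩)
        (fun x hx => (hp _ hx).hasDerivWithinAt)
      refine hin.trans ?_
      have hmono : volume.real (Icc α₁ β₁ \ (fun x => (x, y)) ⁻¹' K) ≤
          volume.real (Icc a₁ b₁ \ (fun x => (x, y)) ⁻¹' K) :=
        measureReal_mono (sdiff_subset_sdiff_left (Icc_subset_Icc ha₁ hb₁))
          (ne_top_of_le_ne_top (by simp) (measure_mono (sdiff_subset : _ ⊆ Icc a₁ b₁)))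
      refine (mul_le_mul_of_nonneg_left hmono (by positivity)).trans
        (mul_le_mul_of_nonneg_right ?_ measureReal_nonneg)
      rw [hC]
      nlinarith [mul_nonneg N.2 hratio, N.2]
  have hJ0 : ∀ y ∉ Icc α₂ β₂, ∫ x in (fun x => (x, y)) ⁻¹' K, P (x, y) = 0 := by
    intro y hy
    have : (fun x => (x, y)) ⁻¹' K = ∅ := eq_empty_of_forall_notMem fun x hx => hy (hKR hx).2
    simp [this]
  rw [eJ, ← setIntegral_eq_integral_of_forall_compl_eq_zero hJ0, intervalIntegral.integral_of_le hαβ₂,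
    ← integral_Icc_eq_integral_Ioc,
    ← integral_sub ((intervalIntegrable_iff_integrableOn_Icc_of_le hαβ₂).1 hw) iJ.integrableOn, em,
    ← integral_const_mul]
  refine (norm_integral_le_of_norm_le (im.const_mul C).integrableOn
    ((ae_restrict_iff' measurableSet_Icc).2 (Eventually.of_forall hpt))).trans ?_
  refine setIntegral_le_integral (im.const_mul C) (Eventually.of_forall fun y => ?_)
  have : 0 ≤ (b₂ - a₂) / (b₁ - a₁) := div_nonneg (by linarith) hpos.le
  exact mul_nonneg (mul_nonneg N.2 (by positivity)) measureReal_nonneg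

/-- This is `horizontal_estimate` with the coordinates swapped. -/
theorem vertical_estimate {a₁ b₁ a₂ b₂ α₁ β₁ α₂ β₂ : ℝ} (hab₂ : a₂ < b₂)
    (ha₁ : a₁ ≤ α₁) (hαβ₁ : α₁ ≤ β₁) (hb₁ : β₁ ≤ b₁) (ha₂ : a₂ ≤ α₂) (hb₂ : β₂ ≤ b₂)
    {K : Set (ℝ × ℝ)} (hK : IsClosed K) (hKR : K ⊆ Icc α₁ β₁ ×ˢ Icc α₂ β₂)
    {xa xb : ℝ} (hxa : (xa, α₂) ∈ K) (hxb : (xb, β₂) ∈ K)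
    {w : ℝ → ℝ → ℂ} {P : ℝ × ℝ → ℂ} {N : ℝ≥0}
    (hlip₁ : ∀ z ∈ K, ∀ x ∈ Icc a₁ b₁, ‖w x z.2 - w z.1 z.2‖ ≤ N * |x - z.1|)
    (hlip₂ : ∀ z ∈ K, ∀ y ∈ Icc a₂ b₂, ‖w z.1 y - w z.1 z.2‖ ≤ N * |y - z.2|)
    (hp : ∀ z ∈ K, HasDerivAt (fun y => w z.1 y) (P z) z.2)
    (hP : IntegrableOn P K)
    (hw : IntervalIntegrable (fun x => w x β₂ - w x α₂) volume α₁ β₁) :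
    ‖(∫ x in α₁..β₁, (w x β₂ - w x α₂)) - ∫ z in K, P z‖ ≤
      N * (10 + 3 * ((b₁ - a₁) / (b₂ - a₂))) *
        volume.real ((Icc a₁ b₁ ×ˢ Icc a₂ b₂) \ K) := by
  have hmp : MeasurePreserving (Prod.swap : ℝ × ℝ → ℝ × ℝ) volume volume :=
    Measure.measurePreserving_swap
  have hemb : MeasurableEmbedding (Prod.swap : ℝ × ℝ → ℝ × ℝ) :=
    MeasurableEquiv.prodComm.measurableEmbedding
  have hKs : IsClosed (Prod.swap ⁻¹' K) := hK.preimage continuous_swap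
  have key := horizontal_estimate (K := Prod.swap ⁻¹' K) (w := fun x y => w y x)
    (P := P ∘ Prod.swap) (N := N) hab₂ ha₂ hb₂ ha₁ hαβ₁ hb₁ hKs
    (fun z hz => ⟨(hKR hz).2, (hKR hz).1⟩) (ya := xa) (yb := xb) hxa hxb
    (fun z hz => hlip₂ _ hz) (fun z hz => hlip₁ _ hz) (fun z hz => hp _ hz)
    ((hmp.integrableOn_comp_preimage hemb).2 hP) hw
  have e1 : ∫ z in Prod.swap ⁻¹' K, (P ∘ Prod.swap) z = ∫ z in K, P z :=
    hmp.setIntegral_preimage_emb hemb P K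
  have e2 : volume.real ((Icc a₂ b₂ ×ˢ Icc a₁ b₁) \ Prod.swap ⁻¹' K) =
      volume.real ((Icc a₁ b₁ ×ˢ Icc a₂ b₂) \ K) := by
    rw [← hmp.measureReal_preimage
      ((measurableSet_Icc.prod measurableSet_Icc).diff hK.measurableSet).nullMeasurableSet,
      preimage_sdiff, preimage_swap_prod]
  rw [e1, e2] at key
  exact key

end LoomanMenchoff

/-! ### Boundary integrals over rectangles, and their vanishing by bisection. -/

namespace LoomanMenchoff

open MeasureTheory
open scoped NNReal

/-- The integral of `w (x, y) d(x + iy)` along the boundary of a rectangle. -/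
noncomputable def rectInt (w : ℝ → ℝ → ℂ) (a₁ b₁ a₂ b₂ : ℝ) : ℂ :=
  (∫ x in a₁..b₁, w x a₂) - (∫ x in a₁..b₁, w x b₂) +
    Complex.I * (∫ y in a₂..b₂, w b₁ y) - Complex.I * ∫ y in a₂..b₂, w a₁ y

section

variable {w : ℝ → ℝ → ℂ}

theorem intervalIntegrable_horizontal (hw : Continuous (Function.uncurry w)) (y a b : ℝ) :
    IntervalIntegrable (fun x => w x y) volume a b :=
  (hw.comp (Continuous.prodMk_left y)).intervalIntegrable a b

theorem intervalIntegrable_vertical (hw : Continuous (Function.uncurry w)) (x a b : ℝ) :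
    IntervalIntegrable (fun y => w x y) volume a b :=
  (hw.comp (Continuous.prodMk_right x)).intervalIntegrable a b

theorem rectInt_add_horizontal (hw : Continuous (Function.uncurry w)) (a m b a₂ b₂ : ℝ) :
    rectInt w a m a₂ b₂ + rectInt w m b a₂ b₂ = rectInt w a b a₂ b₂ := by
  have h : ∀ y, (∫ x in a..m, w x y) + ∫ x in m..b, w x y = ∫ x in a..b, w x y := fun y =>
    intervalIntegral.integral_add_adjacent_intervals (intervalIntegrable_horizontal hw y a m)
      (intervalIntegrable_horizontal hw y m b)
  simp only [rectInt, ← h]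
  ring

theorem rectInt_add_vertical (hw : Continuous (Function.uncurry w)) (a₁ b₁ a m b : ℝ) :
    rectInt w a₁ b₁ a m + rectInt w a₁ b₁ m b = rectInt w a₁ b₁ a b := by
  have h : ∀ x, (∫ y in a..m, w x y) + ∫ y in m..b, w x y = ∫ y in a..b, w x y := fun x =>
    intervalIntegral.integral_add_adjacent_intervals (intervalIntegrable_vertical hw x a m)
      (intervalIntegrable_vertical hw x m b)
  simp only [rectInt, ← h]
  ring

/-- On the rectangle `[a₁, b₁] × [a₂, b₂]` the function `w` is Lipschitz along both axes at the
points of `F`, has there the partial derivatives `P` and `i P`, and has vanishing boundary integrals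
over the subrectangles whose interior does not meet `F`. -/
structure Controlled (w : ℝ → ℝ → ℂ) (F : Set (ℝ × ℝ)) (P : ℝ × ℝ → ℂ) (N : ℝ≥0)
    (a₁ b₁ a₂ b₂ : ℝ) : Prop where
  lip₁ : ∀ z ∈ F ∩ Icc a₁ b₁ ×ˢ Icc a₂ b₂, ∀ x ∈ Icc a₁ b₁, ‖w x z.2 - w z.1 z.2‖ ≤ N * |x - z.1|
  lip₂ : ∀ z ∈ F ∩ Icc a₁ b₁ ×ˢ Icc a₂ b₂, ∀ y ∈ Icc a₂ b₂, ‖w z.1 y - w z.1 z.2‖ ≤ N * |y - z.2|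
  deriv₁ : ∀ z ∈ F ∩ Icc a₁ b₁ ×ˢ Icc a₂ b₂, HasDerivAt (fun x => w x z.2) (P z) z.1
  deriv₂ : ∀ z ∈ F ∩ Icc a₁ b₁ ×ˢ Icc a₂ b₂, HasDerivAt (fun y => w z.1 y) (Complex.I * P z) z.2
  integrable : IntegrableOn P (F ∩ Icc a₁ b₁ ×ˢ Icc a₂ b₂)
  rectInt_eq_zero : ∀ α₁ β₁ α₂ β₂, a₁ ≤ α₁ → α₁ ≤ β₁ → β₁ ≤ b₁ → a₂ ≤ α₂ → α₂ ≤ β₂ → β₂ ≤ b₂ →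
    Disjoint F (Ioo α₁ β₁ ×ˢ Ioo α₂ β₂) → rectInt w α₁ β₁ α₂ β₂ = 0

variable {F : Set (ℝ × ℝ)} {P : ℝ × ℝ → ℂ} {N : ℝ≥0} {a₁ b₁ a₂ b₂ : ℝ}

theorem Controlled.mono (h : Controlled w F P N a₁ b₁ a₂ b₂) {α₁ β₁ α₂ β₂ : ℝ}
    (ha₁ : a₁ ≤ α₁) (hb₁ : β₁ ≤ b₁) (ha₂ : a₂ ≤ α₂) (hb₂ : β₂ ≤ b₂) :
    Controlled w F P N α₁ β₁ α₂ β₂ := by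
  have s₁ := Icc_subset_Icc ha₁ hb₁
  have s₂ := Icc_subset_Icc ha₂ hb₂
  have s : F ∩ Icc α₁ β₁ ×ˢ Icc α₂ β₂ ⊆ F ∩ Icc a₁ b₁ ×ˢ Icc a₂ b₂ :=
    inter_subset_inter_right _ (prod_mono s₁ s₂)
  exact ⟨fun z hz x hx => h.lip₁ z (s hz) x (s₁ hx), fun z hz y hy => h.lip₂ z (s hz) y (s₂ hy),
    fun z hz => h.deriv₁ z (s hz), fun z hz => h.deriv₂ z (s hz), h.integrable.mono_set s,
    fun _ _ _ _ h1 h2 h3 h4 h5 h6 => h.rectInt_eq_zero _ _ _ _ (ha₁.trans h1) h2 (h3.trans hb₁)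
      (ha₂.trans h4) h5 (h6.trans hb₂)⟩

/-- Cut the rectangle down to the smallest one around the part of `F` in it; the four strips removed
have interiors that miss `F` and contribute nothing. On what remains, the two pairs of opposite
sides give `I * ∫ P` with opposite signs, which is where the Cauchy–Riemann equations enter. -/
theorem Controlled.norm_rectInt_le (h : Controlled w F P N a₁ b₁ a₂ b₂)
    (hw : Continuous (Function.uncurry w)) (hF : IsClosed F) (hab₁ : a₁ < b₁) (hab₂ : a₂ < b₂) :
    ‖rectInt w a₁ b₁ a₂ b₂‖ ≤
      N * (20 + 3 * ((b₁ - a₁) / (b₂ - a₂)) + 3 * ((b₂ - a₂) / (b₁ - a₁))) *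
        volume.real ((Icc a₁ b₁ ×ˢ Icc a₂ b₂) \ F) := by
  set Q := Icc a₁ b₁ ×ˢ Icc a₂ b₂ with hQ
  have hr₁ : 0 ≤ (b₁ - a₁) / (b₂ - a₂) := div_nonneg (by linarith) (by linarith)
  have hr₂ : 0 ≤ (b₂ - a₂) / (b₁ - a₁) := div_nonneg (by linarith) (by linarith)
  rcases (F ∩ Q).eq_empty_or_nonempty with hem | hne
  · have hd : Disjoint F (Ioo a₁ b₁ ×ˢ Ioo a₂ b₂) :=
      (disjoint_iff_inter_eq_empty.2 hem).mono_right
        (prod_mono Ioo_subset_Icc_self Ioo_subset_Icc_self)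
    rw [h.rectInt_eq_zero a₁ b₁ a₂ b₂ le_rfl hab₁.le le_rfl le_rfl hab₂.le le_rfl hd, norm_zero]
    positivity
  have hKc : IsCompact (F ∩ Q) := (isCompact_Icc.prod isCompact_Icc).inter_left hF
  obtain ⟨⟨α₁, ya⟩, hza, hmina⟩ := hKc.exists_isMinOn hne continuous_fst.continuousOn
  obtain ⟨⟨β₁, yb⟩, hzb, hmaxb⟩ := hKc.exists_isMaxOn hne continuous_fst.continuousOn
  obtain ⟨⟨xa, α₂⟩, hwa, hmina'⟩ := hKc.exists_isMinOn hne continuous_snd.continuousOn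
  obtain ⟨⟨xb, β₂⟩, hwb, hmaxb'⟩ := hKc.exists_isMaxOn hne continuous_snd.continuousOn
  have hKR : F ∩ Q ⊆ Icc α₁ β₁ ×ˢ Icc α₂ β₂ := fun z hz =>
    ⟨⟨hmina hz, hmaxb hz⟩, ⟨hmina' hz, hmaxb' hz⟩⟩
  have ha₁ : a₁ ≤ α₁ := hza.2.1.1
  have hb₁ : β₁ ≤ b₁ := hzb.2.1.2
  have ha₂ : a₂ ≤ α₂ := hwa.2.2.1
  have hb₂ : β₂ ≤ b₂ := hwb.2.2.2
  have hαβ₁ : α₁ ≤ β₁ := (hKR hza).1.2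
  have hαβ₂ : α₂ ≤ β₂ := (hKR hwa).2.2
  have hdis : ∀ γ₁ δ₁ γ₂ δ₂ : ℝ, a₁ ≤ γ₁ → δ₁ ≤ b₁ → a₂ ≤ γ₂ → δ₂ ≤ b₂ →
      (δ₁ ≤ α₁ ∨ β₁ ≤ γ₁ ∨ δ₂ ≤ α₂ ∨ β₂ ≤ γ₂) → Disjoint F (Ioo γ₁ δ₁ ×ˢ Ioo γ₂ δ₂) := by
    intro γ₁ δ₁ γ₂ δ₂ h1 h2 h3 h4 hor
    refine disjoint_left.2 fun z hzF hz => ?_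
    have := hKR ⟨hzF, ⟨h1.trans hz.1.1.le, hz.1.2.le.trans h2⟩,
      ⟨h3.trans hz.2.1.le, hz.2.2.le.trans h4⟩⟩
    rcases hor with h | h | h | h
    · exact absurd (this.1.1.trans_lt hz.1.2) (not_lt.2 h)
    · exact absurd (hz.1.1.trans_le this.1.2) (not_lt.2 h)
    · exact absurd (this.2.1.trans_lt hz.2.2) (not_lt.2 h)
    · exact absurd (hz.2.1.trans_le this.2.2) (not_lt.2 h)
  have z1 : rectInt w a₁ α₁ a₂ b₂ = 0 := h.rectInt_eq_zero _ _ _ _ le_rfl ha₁ (hαβ₁.trans hb₁)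
    le_rfl hab₂.le le_rfl (hdis _ _ _ _ le_rfl (hαβ₁.trans hb₁) le_rfl le_rfl (by simp))
  have z2 : rectInt w β₁ b₁ a₂ b₂ = 0 := h.rectInt_eq_zero _ _ _ _ (ha₁.trans hαβ₁) hb₁ le_rfl
    le_rfl hab₂.le le_rfl (hdis _ _ _ _ (ha₁.trans hαβ₁) le_rfl le_rfl le_rfl (by simp))
  have z3 : rectInt w α₁ β₁ a₂ α₂ = 0 := h.rectInt_eq_zero _ _ _ _ ha₁ hαβ₁ hb₁
    le_rfl ha₂ (hαβ₂.trans hb₂) (hdis _ _ _ _ ha₁ hb₁ le_rfl (hαβ₂.trans hb₂) (by simp))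
  have z4 : rectInt w α₁ β₁ β₂ b₂ = 0 := h.rectInt_eq_zero _ _ _ _ ha₁ hαβ₁ hb₁
    (ha₂.trans hαβ₂) hb₂ le_rfl (hdis _ _ _ _ ha₁ hb₁ (ha₂.trans hαβ₂) le_rfl (by simp))
  have hred : rectInt w a₁ b₁ a₂ b₂ = rectInt w α₁ β₁ α₂ β₂ := by
    rw [← rectInt_add_horizontal hw a₁ α₁ b₁, ← rectInt_add_horizontal hw α₁ β₁ b₁,
      ← rectInt_add_vertical hw α₁ β₁ a₂ α₂ b₂, ← rectInt_add_vertical hw α₁ β₁ α₂ β₂ b₂, z1, z2, z3,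
      z4]
    ring
  have hKcl : IsClosed (F ∩ Q) := hKc.isClosed
  have e1 := horizontal_estimate hab₁ ha₁ hb₁ ha₂ hαβ₂ hb₂ hKcl hKR hza hzb h.lip₁ h.lip₂
    h.deriv₁ h.integrable ((intervalIntegrable_vertical hw _ _ _).sub
      (intervalIntegrable_vertical hw _ _ _))
  have e2 := vertical_estimate hab₂ ha₁ hαβ₁ hb₁ ha₂ hb₂ hKcl hKR hwa hwb h.lip₁ h.lip₂
    h.deriv₂ (h.integrable.const_mul Complex.I) ((intervalIntegrable_horizontal hw _ _ _).sub
      (intervalIntegrable_horizontal hw _ _ _))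
  rw [← hQ, sdiff_inter_self_eq_sdiff] at e1 e2
  rw [integral_const_mul] at e2
  rw [intervalIntegral.integral_sub (intervalIntegrable_vertical hw _ _ _)
    (intervalIntegrable_vertical hw _ _ _)] at e1
  rw [intervalIntegral.integral_sub (intervalIntegrable_horizontal hw _ _ _)
    (intervalIntegrable_horizontal hw _ _ _)] at e2
  set p := ∫ z in F ∩ Q, P z
  have hsplit : rectInt w α₁ β₁ α₂ β₂ =
      Complex.I * ((∫ y in α₂..β₂, w β₁ y) - (∫ y in α₂..β₂, w α₁ y) - p) -
      ((∫ x in α₁..β₁, w x β₂) - (∫ x in α₁..β₁, w x α₂) - Complex.I * p) := by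
    rw [rectInt]; ring
  rw [hred, hsplit]
  refine (norm_sub_le _ _).trans ?_
  rw [norm_mul, Complex.norm_I, one_mul]
  refine (add_le_add e1 e2).trans (le_of_eq ?_)
  ring

/-- Bisection improves the estimate by the measure of the complement of `F` to one by the measure of
the points of small positive distance from `F`. -/
theorem Controlled.norm_rectInt_le_of_infDist (hw : Continuous (Function.uncurry w))
    (hF : IsClosed F) (n : ℕ) {ρ δ : ℝ} (hρ : 0 < ρ) :
    ∀ {a₁ b₁ a₂ b₂ : ℝ}, Controlled w F P N a₁ b₁ a₂ b₂ → a₁ < b₁ → b₂ - a₂ = ρ * (b₁ - a₁) →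
    b₁ - a₁ ≤ 2 ^ n * δ → b₂ - a₂ ≤ 2 ^ n * δ → ‖rectInt w a₁ b₁ a₂ b₂‖ ≤
      N * (20 + 3 * ρ⁻¹ + 3 * ρ) *
        volume.real ((Ioc a₁ b₁ ×ˢ Ioc a₂ b₂) ∩ {z | z ∉ F ∧ Metric.infDist z F ≤ δ}) := by
  have hm : MeasurableSet {z | z ∉ F ∧ Metric.infDist z F ≤ δ} :=
    hF.measurableSet.compl.inter
      (isClosed_le (Metric.continuous_infDist_pt F) continuous_const).measurableSet
  induction n with
  | zero =>
    intro a₁ b₁ a₂ b₂ h hab₁ hab₂ hd₁ hd₂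
    have hpos : 0 < b₁ - a₁ := sub_pos.2 hab₁
    have hab₂' : a₂ < b₂ := sub_pos.1 (hab₂ ▸ mul_pos hρ hpos)
    -- Either the integral is zero, or the rectangle contains a point of `F`; then all its points
    -- are within `δ` of `F` in the maximum metric, as both sides are at most `δ`.
    rcases (F ∩ Icc a₁ b₁ ×ˢ Icc a₂ b₂).eq_empty_or_nonempty with hem | ⟨z, hzF, hzQ⟩
    · have hd : Disjoint F (Ioo a₁ b₁ ×ˢ Ioo a₂ b₂) :=
        (disjoint_iff_inter_eq_empty.2 hem).mono_right
          (prod_mono Ioo_subset_Icc_self Ioo_subset_Icc_self)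
      rw [h.rectInt_eq_zero a₁ b₁ a₂ b₂ le_rfl hab₁.le le_rfl le_rfl hab₂'.le le_rfl hd, norm_zero]
      positivity
    have hr₁ : (b₁ - a₁) / (b₂ - a₂) = ρ⁻¹ := by rw [hab₂]; field_simp
    have hr₂ : (b₂ - a₂) / (b₁ - a₁) = ρ := by rw [hab₂]; field_simp
    have key := h.norm_rectInt_le hw hF hab₁ hab₂'
    rw [hr₁, hr₂] at key
    refine key.trans (mul_le_mul_of_nonneg_left (le_of_eq ?_) (by positivity))
    -- Half-open rectangles make the four quarters of the bisection disjoint; the boundary has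
    -- measure zero.
    have hae : (Icc a₁ b₁ ×ˢ Icc a₂ b₂ : Set (ℝ × ℝ)) =ᵐ[volume] Ioc a₁ b₁ ×ˢ Ioc a₂ b₂ :=
      Measure.set_prod_ae_eq Ioc_ae_eq_Icc.symm Ioc_ae_eq_Icc.symm
    rw [measureReal_congr (hae.diff (ae_eq_refl F))]
    congr 1
    ext y
    refine ⟨fun hy => ⟨hy.1, hy.2, (Metric.infDist_le_dist_of_mem hzF).trans ?_⟩,
      fun hy => ⟨hy.1, hy.2.1⟩⟩
    rw [pow_zero, one_mul] at hd₁ hd₂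
    rw [Prod.dist_eq, Real.dist_eq, Real.dist_eq]
    refine max_le (abs_le.2 ⟨?_, ?_⟩) (abs_le.2 ⟨?_, ?_⟩) <;>
    linarith [hy.1.1.1, hy.1.1.2, hy.1.2.1, hy.1.2.2, hzQ.1.1, hzQ.1.2, hzQ.2.1, hzQ.2.2]
  | succ n ih =>
    intro a₁ b₁ a₂ b₂ h hab₁ hab₂ hd₁ hd₂
    have hpos : 0 < b₁ - a₁ := sub_pos.2 hab₁
    have hab₂' : a₂ < b₂ := sub_pos.1 (hab₂ ▸ mul_pos hρ hpos)
    set S := {z | z ∉ F ∧ Metric.infDist z F ≤ δ}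
    set m₁ := (a₁ + b₁) / 2 with hm₁
    set m₂ := (a₂ + b₂) / 2 with hm₂
    rw [pow_succ] at hd₁ hd₂
    have e₁ : m₁ - a₁ = (b₁ - a₁) / 2 := by linarith
    have e₂ : m₂ - a₂ = (b₂ - a₂) / 2 := by linarith
    have e₃ : b₁ - m₁ = (b₁ - a₁) / 2 := by linarith
    have e₄ : b₂ - m₂ = (b₂ - a₂) / 2 := by linarith
    have i1 := ih (h.mono (β₁ := m₁) (β₂ := m₂) le_rfl (by linarith) le_rfl (by linarith))
      (by linarith) (by rw [e₂, e₁, hab₂]; ring) (by linarith) (by linarith)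
    have i2 := ih (h.mono (α₁ := m₁) (β₂ := m₂) (by linarith) le_rfl le_rfl (by linarith))
      (by linarith) (by rw [e₂, e₃, hab₂]; ring) (by linarith) (by linarith)
    have i3 := ih (h.mono (β₁ := m₁) (α₂ := m₂) le_rfl (by linarith) (by linarith) le_rfl)
      (by linarith) (by rw [e₄, e₁, hab₂]; ring) (by linarith) (by linarith)
    have i4 := ih (h.mono (α₁ := m₁) (α₂ := m₂) (by linarith) le_rfl (by linarith) le_rfl)
      (by linarith) (by rw [e₄, e₃, hab₂]; ring) (by linarith) (by linarith)
    have hfin : ∀ a b c d : ℝ, volume ((Ioc a b ×ˢ Ioc c d) ∩ S) ≠ ⊤ := fun a b c d =>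
      ne_top_of_le_ne_top (isCompact_Icc.prod isCompact_Icc).measure_lt_top.ne
        (measure_mono (inter_subset_left.trans (prod_mono Ioc_subset_Icc_self Ioc_subset_Icc_self)))
    have hx : ∀ c d : ℝ, volume.real ((Ioc a₁ m₁ ×ˢ Ioc c d) ∩ S) +
        volume.real ((Ioc m₁ b₁ ×ˢ Ioc c d) ∩ S) = volume.real ((Ioc a₁ b₁ ×ˢ Ioc c d) ∩ S) := by
      intro c d
      rw [← Ioc_union_Ioc_eq_Ioc (show a₁ ≤ m₁ by linarith) (show m₁ ≤ b₁ by linarith), union_prod,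
        union_inter_distrib_right, measureReal_union _
          (((measurableSet_Ioc.prod measurableSet_Ioc).inter hm)) (hfin _ _ _ _) (hfin _ _ _ _)]
      exact disjoint_left.2 fun z h1 h2 => absurd h1.1.1.2 (not_le.2 h2.1.1.1)
    have hy : volume.real ((Ioc a₁ b₁ ×ˢ Ioc a₂ m₂) ∩ S) +
        volume.real ((Ioc a₁ b₁ ×ˢ Ioc m₂ b₂) ∩ S) = volume.real ((Ioc a₁ b₁ ×ˢ Ioc a₂ b₂) ∩ S) := by
      rw [← Ioc_union_Ioc_eq_Ioc (show a₂ ≤ m₂ by linarith) (show m₂ ≤ b₂ by linarith), prod_union,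
        union_inter_distrib_right, measureReal_union _
          (((measurableSet_Ioc.prod measurableSet_Ioc).inter hm)) (hfin _ _ _ _) (hfin _ _ _ _)]
      exact disjoint_left.2 fun z h1 h2 => absurd h1.1.2.2 (not_le.2 h2.1.2.1)
    rw [← hy, ← hx, ← hx, ← rectInt_add_vertical hw a₁ b₁ a₂ m₂ b₂,
      ← rectInt_add_horizontal hw a₁ m₁ b₁ a₂ m₂, ← rectInt_add_horizontal hw a₁ m₁ b₁ m₂ b₂]
    have t1 := norm_add_le (rectInt w a₁ m₁ a₂ m₂ + rectInt w m₁ b₁ a₂ m₂)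
      (rectInt w a₁ m₁ m₂ b₂ + rectInt w m₁ b₁ m₂ b₂)
    have t2 := norm_add_le (rectInt w a₁ m₁ a₂ m₂) (rectInt w m₁ b₁ a₂ m₂)
    have t3 := norm_add_le (rectInt w a₁ m₁ m₂ b₂) (rectInt w m₁ b₁ m₂ b₂)
    linarith

/-- After `n` bisections only points off `F` at distance at most `D / 2 ^ n` count. As `F` is
closed, these sets decrease to the empty set, so their measures tend to `0`. -/
theorem Controlled.rectInt_eq_zero_of_isClosed (h : Controlled w F P N a₁ b₁ a₂ b₂)
    (hw : Continuous (Function.uncurry w)) (hF : IsClosed F) (hab₁ : a₁ ≤ b₁) (hab₂ : a₂ ≤ b₂) :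
    rectInt w a₁ b₁ a₂ b₂ = 0 := by
  rcases hab₁.eq_or_lt with rfl | hab₁
  · exact h.rectInt_eq_zero _ _ _ _ le_rfl le_rfl le_rfl le_rfl hab₂ le_rfl (by simp)
  rcases hab₂.eq_or_lt with rfl | hab₂
  · exact h.rectInt_eq_zero _ _ _ _ le_rfl hab₁.le le_rfl le_rfl le_rfl le_rfl (by simp)
  rcases F.eq_empty_or_nonempty with hem | hFne
  · exact h.rectInt_eq_zero _ _ _ _ le_rfl hab₁.le le_rfl le_rfl hab₂.le le_rfl (by simp [hem])
  have hp₁ : 0 < b₁ - a₁ := sub_pos.2 hab₁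
  have hp₂ : 0 < b₂ - a₂ := sub_pos.2 hab₂
  set ρ := (b₂ - a₂) / (b₁ - a₁) with hρ
  have hρ0 : 0 < ρ := div_pos hp₂ hp₁
  set D := max (b₁ - a₁) (b₂ - a₂)
  set T : ℕ → Set (ℝ × ℝ) := fun n =>
    (Ioc a₁ b₁ ×ˢ Ioc a₂ b₂) ∩ {z | z ∉ F ∧ Metric.infDist z F ≤ D / 2 ^ n} with hT
  have hD : 0 < D := lt_max_of_lt_left hp₁
  have hbound : ∀ n, ‖rectInt w a₁ b₁ a₂ b₂‖ ≤
      N * (20 + 3 * ρ⁻¹ + 3 * ρ) * volume.real (T n) := fun n => by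
    have e : (2 : ℝ) ^ n * (D / 2 ^ n) = D := by field_simp
    exact Controlled.norm_rectInt_le_of_infDist hw hF n hρ0 h hab₁ (by rw [hρ]; field_simp)
      ((le_max_left _ _).trans_eq e.symm) ((le_max_right _ _).trans_eq e.symm)
  have hTm : ∀ n, MeasurableSet (T n) := fun n =>
    (measurableSet_Ioc.prod measurableSet_Ioc).inter (hF.measurableSet.compl.inter
      (isClosed_le (Metric.continuous_infDist_pt F) continuous_const).measurableSet)
  have hanti : Antitone T := by
    intro m n hmn z hz
    refine ⟨hz.1, hz.2.1, hz.2.2.trans ?_⟩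
    exact div_le_div_of_nonneg_left hD.le (by positivity) (pow_le_pow_right₀ (by norm_num) hmn)
  have hD0 : Tendsto (fun n : ℕ => D / 2 ^ n) atTop (𝓝 0) := by
    simpa [div_eq_mul_inv] using
      (tendsto_pow_atTop_nhds_zero_of_lt_one (r := (2 : ℝ)⁻¹) (by norm_num) (by norm_num)).const_mul D
  have hInter : ⋂ n, T n = ∅ := by
    refine eq_empty_of_forall_notMem fun z hz => ?_
    rw [mem_iInter] at hz
    have h0 : Metric.infDist z F ≤ 0 := ge_of_tendsto' hD0 fun n => (hz n).2.2
    exact (hz 0).2.1 ((hF.mem_iff_infDist_zero hFne).2 (le_antisymm h0 Metric.infDist_nonneg))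
  have hlim := tendsto_measure_iInter_atTop (μ := volume) (fun n => (hTm n).nullMeasurableSet) hanti
    ⟨0, ne_top_of_le_ne_top (isCompact_Icc.prod isCompact_Icc).measure_lt_top.ne
        (measure_mono (inter_subset_left.trans (prod_mono Ioc_subset_Icc_self Ioc_subset_Icc_self)))⟩
  rw [hInter, measure_empty] at hlim
  have hlim' : Tendsto (fun n => N * (20 + 3 * ρ⁻¹ + 3 * ρ) * volume.real (T n)) atTop (𝓝 0) := by
    simpa [Measure.real] using
      ((ENNReal.tendsto_toReal ENNReal.zero_ne_top).comp hlim).const_mul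
        (N * (20 + 3 * ρ⁻¹ + 3 * ρ))
  exact norm_le_zero_iff.1 (ge_of_tendsto' hlim' hbound)

end

end LoomanMenchoff

/-! ### The Looman–Menchoff theorem. -/

namespace LoomanMenchoff

open MeasureTheory Complex
open scoped NNReal

theorem rectInt_swap_horizontal (w : ℝ → ℝ → ℂ) (a₁ b₁ a₂ b₂ : ℝ) :
    rectInt w b₁ a₁ a₂ b₂ = -rectInt w a₁ b₁ a₂ b₂ := by
  simp only [rectInt, intervalIntegral.integral_symm a₁ b₁]
  ring

theorem rectInt_swap_vertical (w : ℝ → ℝ → ℂ) (a₁ b₁ a₂ b₂ : ℝ) :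
    rectInt w a₁ b₁ b₂ a₂ = -rectInt w a₁ b₁ a₂ b₂ := by
  simp only [rectInt, intervalIntegral.integral_symm a₂ b₂]
  ring

theorem isConservativeOn_of_rectInt_eq_zero {G : ℂ → ℂ} {U : Set ℂ}
    (h : ∀ a₁ b₁ a₂ b₂ : ℝ, a₁ ≤ b₁ → a₂ ≤ b₂ → Icc a₁ b₁ ×ℂ Icc a₂ b₂ ⊆ U →
      rectInt (fun x y => G (x + y * I)) a₁ b₁ a₂ b₂ = 0) : IsConservativeOn G U := by
  intro z w hzw
  rw [← add_eq_zero_iff_eq_neg, wedgeIntegral_add_wedgeIntegral_eq]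
  change rectInt (fun x y => G (x + y * I)) z.re w.re z.im w.im = 0
  rw [Rectangle] at hzw
  rcases le_total z.re w.re with h1 | h1 <;> rcases le_total z.im w.im with h2 | h2
  · rw [uIcc_of_le h1, uIcc_of_le h2] at hzw
    exact h _ _ _ _ h1 h2 hzw
  · rw [uIcc_of_le h1, uIcc_of_ge h2] at hzw
    rw [rectInt_swap_vertical, h _ _ _ _ h1 h2 hzw, neg_zero]
  · rw [uIcc_of_ge h1, uIcc_of_le h2] at hzw
    rw [rectInt_swap_horizontal, h _ _ _ _ h1 h2 hzw, neg_zero]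
  · rw [uIcc_of_ge h1, uIcc_of_ge h2] at hzw
    rw [rectInt_swap_horizontal, rectInt_swap_vertical, h _ _ _ _ h1 h2 hzw, neg_zero, neg_zero]

/-- `P` is measurable as a pointwise limit on `K` of continuous difference quotients, and the
Lipschitz condition bounds it by `N`. -/
theorem integrableOn_of_hasDerivAt_of_lipschitz {w : ℝ → ℝ → ℂ}
    (hw : Continuous (Function.uncurry w)) {K : Set (ℝ × ℝ)} (hK : MeasurableSet K)
    (hfin : volume K ≠ ⊤) {P : ℝ × ℝ → ℂ} {N : ℝ≥0}
    (hd : ∀ z ∈ K, HasDerivAt (fun x => w x z.2) (P z) z.1)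
    (hlip : ∀ z ∈ K, ∀ᶠ x in 𝓝 z.1, ‖w x z.2 - w z.1 z.2‖ ≤ N * |x - z.1|) :
    IntegrableOn P K := by
  have hseq : Tendsto (fun n : ℕ => ((n : ℝ) + 1)⁻¹) atTop (𝓝[≠] 0) := by
    refine tendsto_nhdsWithin_iff.2 ⟨?_, Eventually.of_forall fun n => ?_⟩
    · simpa using tendsto_one_div_add_atTop_nhds_zero_nat (𝕜 := ℝ)
    · exact (by positivity : ((n : ℝ) + 1)⁻¹ ≠ 0)
  refine IntegrableOn.of_bound hfin.lt_top ?_ N ((ae_restrict_iff' hK).2 (Eventually.of_forall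
    fun z hz => (hd z hz).le_of_lip' N.2 (hlip z hz)))
  refine aestronglyMeasurable_of_tendsto_ae (u := atTop)
    (f := fun (n : ℕ) (z : ℝ × ℝ) => (((n : ℝ) + 1)⁻¹)⁻¹ • (w (z.1 + ((n : ℝ) + 1)⁻¹) z.2 - w z.1 z.2))
    (fun n => ?_) ((ae_restrict_iff' hK).2 (Eventually.of_forall fun z hz =>
      (hd z hz).tendsto_slope_zero.comp hseq))
  have h1 : Continuous fun z : ℝ × ℝ => w (z.1 + ((n : ℝ) + 1)⁻¹) z.2 :=
    hw.comp (f := fun z : ℝ × ℝ => (z.1 + ((n : ℝ) + 1)⁻¹, z.2)) (by fun_prop)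
  have h2 : Continuous fun z : ℝ × ℝ => w z.1 z.2 := hw
  exact ((h1.sub h2).const_smul (((n : ℝ) + 1)⁻¹)⁻¹).aestronglyMeasurable

/-- Rectangles whose interior misses `F` have zero boundary integral by Cauchy's theorem, so
`Controlled` holds on every rectangle in the ball; Morera's theorem concludes. -/
theorem differentiableOn_ball_of_lipschitz_of_differentiableAt {G c : ℂ → ℂ} (hG : Continuous G)
    {z₀ : ℂ} {r : ℝ} {F : Set ℂ} (hF : IsClosed F) {N : ℝ≥0}
    (hd₁ : ∀ z ∈ F ∩ Metric.ball z₀ r, HasDerivAt (fun t : ℝ => G (z + t)) (c z) 0)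
    (hd₂ : ∀ z ∈ F ∩ Metric.ball z₀ r, HasDerivAt (fun t : ℝ => G (z + t * I)) (I * c z) 0)
    (hl₁ : ∀ z ∈ F ∩ Metric.ball z₀ r, ∀ t : ℝ, z + t ∈ Metric.ball z₀ r →
      ‖G (z + t) - G z‖ ≤ N * |t|)
    (hl₂ : ∀ z ∈ F ∩ Metric.ball z₀ r, ∀ t : ℝ, z + t * I ∈ Metric.ball z₀ r →
      ‖G (z + t * I) - G z‖ ≤ N * |t|)
    (hdiff : ∀ z ∈ Metric.ball z₀ r, z ∉ F → DifferentiableAt ℂ G z) :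
    DifferentiableOn ℂ G (Metric.ball z₀ r) := by
  refine ((isConservativeOn_of_rectInt_eq_zero ?_).isExactOn_ball
    hG.continuousOn).differentiableOn Metric.isOpen_ball
  intro a₁ b₁ a₂ b₂ hab₁ hab₂ hsub
  set e : ℝ × ℝ → ℂ := fun p => p.1 + p.2 * I with he
  have hec : Continuous e := by fun_prop
  have hmem : ∀ x ∈ Icc a₁ b₁, ∀ y ∈ Icc a₂ b₂, (x + y * I : ℂ) ∈ Metric.ball z₀ r :=
    fun x hx y hy => hsub (by simpa [mem_reProdIm] using ⟨hx, hy⟩)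
  have hw : Continuous (Function.uncurry fun x y : ℝ => G (x + y * I)) :=
    hG.comp (show Continuous e from hec)
  have hK : ∀ z ∈ e ⁻¹' F ∩ Icc a₁ b₁ ×ˢ Icc a₂ b₂, e z ∈ F ∩ Metric.ball z₀ r :=
    fun z hz => ⟨hz.1, hmem _ hz.2.1 _ hz.2.2⟩
  have ex : ∀ (z : ℝ × ℝ) (x : ℝ), (x + z.2 * I : ℂ) = e z + ((x - z.1 : ℝ) : ℂ) := fun z x => by
    simp only [he, ofReal_sub]; ring
  have ey : ∀ (z : ℝ × ℝ) (y : ℝ), (z.1 + y * I : ℂ) = e z + ((y - z.2 : ℝ) : ℂ) * I :=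
    fun z y => by simp only [he, ofReal_sub]; ring
  have hdx : ∀ z ∈ e ⁻¹' F ∩ Icc a₁ b₁ ×ˢ Icc a₂ b₂,
      HasDerivAt (fun x : ℝ => G (x + z.2 * I)) (c (e z)) z.1 := fun z hz => by
    simp only [ex]
    exact HasDerivAt.comp_sub_const (f := fun t : ℝ => G (e z + t)) z.1 z.1
      (by simpa using hd₁ _ (hK z hz))
  have hdy : ∀ z ∈ e ⁻¹' F ∩ Icc a₁ b₁ ×ˢ Icc a₂ b₂,
      HasDerivAt (fun y : ℝ => G (z.1 + y * I)) (I * c (e z)) z.2 := fun z hz => by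
    simp only [ey]
    exact HasDerivAt.comp_sub_const (f := fun t : ℝ => G (e z + t * I)) z.2 z.2
      (by simpa using hd₂ _ (hK z hz))
  have hlx : ∀ z ∈ e ⁻¹' F ∩ Icc a₁ b₁ ×ˢ Icc a₂ b₂, ∀ x : ℝ, (x + z.2 * I : ℂ) ∈ Metric.ball z₀ r →
      ‖G (x + z.2 * I) - G (z.1 + z.2 * I)‖ ≤ N * |x - z.1| := fun z hz x hx => by
    rw [ex] at hx ⊢
    exact hl₁ _ (hK z hz) _ hx
  have hly : ∀ z ∈ e ⁻¹' F ∩ Icc a₁ b₁ ×ˢ Icc a₂ b₂, ∀ y : ℝ, (z.1 + y * I : ℂ) ∈ Metric.ball z₀ r →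
      ‖G (z.1 + y * I) - G (z.1 + z.2 * I)‖ ≤ N * |y - z.2| := fun z hz y hy => by
    rw [ey] at hy ⊢
    exact hl₂ _ (hK z hz) _ hy
  have hctrl : Controlled (fun x y => G (x + y * I)) (e ⁻¹' F) (c ∘ e) N a₁ b₁ a₂ b₂ := by
    refine ⟨fun z hz x hx => hlx z hz x (hmem x hx _ hz.2.2),
      fun z hz y hy => hly z hz y (hmem _ hz.2.1 y hy), hdx, hdy, ?_, ?_⟩
    · refine integrableOn_of_hasDerivAt_of_lipschitz hw
        ((hF.preimage hec).measurableSet.inter (measurableSet_Icc.prod measurableSet_Icc))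
        (ne_top_of_le_ne_top (isCompact_Icc.prod isCompact_Icc).measure_lt_top.ne
          (measure_mono inter_subset_right)) (N := N) hdx fun z hz => ?_
      have hcont : Continuous fun x : ℝ => (x + z.2 * I : ℂ) := by fun_prop
      exact (hcont.continuousAt.eventually_mem
        (Metric.isOpen_ball.mem_nhds (hK z hz).2)).mono (hlx z hz)
    · intro α₁ β₁ α₂ β₂ h1 h2 h3 h4 h5 h6 hdis
      have := integral_boundary_rect_eq_zero_of_continuousOn_of_differentiableOn G
        ⟨α₁, α₂⟩ ⟨β₁, β₂⟩ hG.continuousOn (fun z hz => ?_)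
      · simpa [rectInt] using this
      · simp only [min_eq_left h2, max_eq_right h2, min_eq_left h5, max_eq_right h5,
          mem_reProdIm] at hz
        have hez : e (z.re, z.im) = z := re_add_im z
        refine (hdiff z ?_ fun hzF => ?_).differentiableWithinAt
        · rw [← hez]
          exact hmem _ ⟨h1.trans hz.1.1.le, hz.1.2.le.trans h3⟩ _
            ⟨h4.trans hz.2.1.le, hz.2.2.le.trans h6⟩
        · exact disjoint_left.1 hdis (show (z.re, z.im) ∈ e ⁻¹' F from
            (congrArg (· ∈ F) hez).mpr hzF) ⟨hz.1, hz.2⟩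
  exact hctrl.rectInt_eq_zero_of_isClosed hw (hF.preimage hec) hab₁ hab₂

/-- Supplies the closed sets for Baire's theorem. -/
theorem isClosed_setOf_increment_le {D F : Set ℂ} (hD : IsOpen D) (hFD : F ⊆ D) {G : ℂ → ℂ}
    (hG : ContinuousOn G D) (v : ℂ) (δ N : ℝ) :
    IsClosed {z : F | ∀ t : ℝ, |t| ≤ δ → (z : ℂ) + t * v ∈ D → ‖G (z + t * v) - G z‖ ≤ N * |t|} := by
  refine IsSeqClosed.isClosed fun u z hu hz t ht hzt => ?_
  have hz' : Tendsto (fun n => (u n : ℂ)) atTop (𝓝 z) := (continuous_subtype_val.tendsto z).comp hz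
  have h1 : Tendsto (fun n => (u n : ℂ) + t * v) atTop (𝓝 (z + t * v)) := hz'.add_const _
  have h2 := ((hG.continuousAt (hD.mem_nhds hzt)).tendsto.comp h1).sub
    ((hG.continuousAt (hD.mem_nhds (hFD z.2))).tendsto.comp hz')
  exact le_of_tendsto h2.norm ((h1.eventually_mem (hD.mem_nhds hzt)).mono fun n hn => hu n t ht hn)

/-- The bound persists for all larger `m`, so one index can serve both coordinate directions. -/
theorem exists_nat_forall_increment_le {D : Set ℂ} {G : ℂ → ℂ} {z v d : ℂ}
    (h : HasDerivAt (fun t : ℝ => G (z + t * v)) d 0) :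
    ∃ n : ℕ, ∀ m : ℕ, n ≤ m → ∀ t : ℝ, |t| ≤ 1 / ((m : ℝ) + 1) → z + t * v ∈ D →
      ‖G (z + t * v) - G z‖ ≤ ((m : ℝ) + 1) * |t| := by
  obtain ⟨C, hC⟩ := h.isBigO_sub.bound
  obtain ⟨ε, hε, hball⟩ := Metric.eventually_nhds_iff.1 hC
  obtain ⟨n₁, hn₁⟩ := exists_nat_gt C
  obtain ⟨n₂, hn₂⟩ := exists_nat_one_div_lt hε
  refine ⟨max n₁ n₂, fun m hm t ht _ => ?_⟩
  have h1 : (n₁ : ℝ) ≤ m := by exact_mod_cast (le_max_left _ _).trans hm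
  have h2 : (1 : ℝ) / (m + 1) ≤ 1 / (n₂ + 1) :=
    Nat.one_div_le_one_div ((le_max_right _ _).trans hm)
  have h3 := hball (y := t) (by rw [Real.dist_eq, sub_zero]; linarith)
  simp only [ofReal_zero, zero_mul, add_zero, sub_zero, Real.norm_eq_abs] at h3
  exact h3.trans (mul_le_mul_of_nonneg_right (by linarith) (abs_nonneg t))

/-- **Looman–Menchoff theorem**: a continuous function whose partial derivatives exist and satisfy
the Cauchy–Riemann equations at every point of an open set is holomorphic there. -/
theorem differentiableOn_of_hasDerivAt_lines {D : Set ℂ} (hD : IsOpen D) {G : ℂ → ℂ}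
    (hG : ContinuousOn G D)
    (hCR : ∀ z ∈ D, ∃ c : ℂ, HasDerivAt (fun t : ℝ => G (z + t)) c 0 ∧
      HasDerivAt (fun t : ℝ => G (z + t * I)) (I * c) 0) :
    DifferentiableOn ℂ G D := by
  choose! c hc₁ hc₂ using hCR
  have hc₁' : ∀ z ∈ D, HasDerivAt (fun t : ℝ => G (z + t * 1)) (c z) 0 := by simpa using hc₁
  -- `V` is the largest open set of holomorphy. Its complement `F` in `D` is locally closed, so
  -- Baire's theorem applies to `F` if it is nonempty.
  set V : Set ℂ := {z | ∀ᶠ y in 𝓝 z, DifferentiableAt ℂ G y} with hV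
  have hVo : IsOpen V := isOpen_setOfPred_eventually_nhds
  set F : Set ℂ := D ∩ Vᶜ with hFdef
  suffices hFe : F = ∅ by
    intro z hz
    have hzV : z ∈ V := by
      by_contra h
      exact hFe.subset ⟨hz, h⟩
    exact (show ∀ᶠ y in 𝓝 z, DifferentiableAt ℂ G y from hzV).self_of_nhds.differentiableWithinAt
  by_contra hne
  have : Nonempty F := (nonempty_iff_ne_empty.2 hne).to_subtype
  have : LocallyCompactSpace F :=
    (hD.isLocallyClosed.inter hVo.isClosed_compl.isLocallyClosed).locallyCompactSpace
  have hFD : F ⊆ D := inter_subset_left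
  let E : ℂ → ℕ → Set F := fun v n => {z : F | ∀ t : ℝ, |t| ≤ 1 / ((n : ℝ) + 1) →
    (z : ℂ) + t * v ∈ D → ‖G (z + t * v) - G z‖ ≤ ((n : ℝ) + 1) * |t|}
  have hEc : ∀ n, IsClosed (E 1 n ∩ E I n) := fun n =>
    (isClosed_setOf_increment_le hD hFD hG _ _ _).inter
      (isClosed_setOf_increment_le hD hFD hG _ _ _)
  have hEu : ⋃ n, (E 1 n ∩ E I n) = univ := by
    refine eq_univ_of_forall fun z => mem_iUnion.2 ?_
    obtain ⟨n₁, h₁⟩ := exists_nat_forall_increment_le (D := D) (hc₁' z (hFD z.2))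
    obtain ⟨n₂, h₂⟩ := exists_nat_forall_increment_le (D := D) (hc₂ z (hFD z.2))
    exact ⟨max n₁ n₂, h₁ _ (le_max_left _ _), h₂ _ (le_max_right _ _)⟩
  obtain ⟨n, z₀, hz₀⟩ := nonempty_interior_of_iUnion_of_closed hEc hEu
  obtain ⟨ε, hε, hεE⟩ := Metric.mem_nhds_iff.1 (mem_interior_iff_mem_nhds.1 hz₀)
  obtain ⟨ε', hε', hε'D⟩ := Metric.mem_nhds_iff.1 (hD.mem_nhds (hFD z₀.2))
  have hn0 : (0 : ℝ) < 1 / ((n : ℝ) + 1) := by positivity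
  -- Half of `1 / (n + 1)` is used so that any two points of the ball are within `1 / (n + 1)`, the
  -- range of the increments controlled by `E`.
  obtain ⟨r, hr, hrm⟩ := exists_between (lt_min hε (lt_min hε' (half_pos hn0)))
  obtain ⟨hrε, hrm⟩ := lt_min_iff.1 hrm
  obtain ⟨hrε', hrn⟩ := lt_min_iff.1 hrm
  have hBD : Metric.closedBall (z₀ : ℂ) r ⊆ D :=
    (Metric.closedBall_subset_ball hrε').trans hε'D
  -- Tietze's theorem gives a function continuous on all of `ℂ` that agrees with `G` on the closed
  -- ball.
  obtain ⟨g, hg⟩ := ContinuousMap.exists_restrict_eq Metric.isClosed_closedBall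
    ⟨(Metric.closedBall (z₀ : ℂ) r).domRestrict G, (hG.mono hBD).domRestrict⟩
  have hgG : ∀ z ∈ Metric.ball (z₀ : ℂ) r, g z = G z := fun z hz =>
    congrArg (fun k : C(Metric.closedBall (z₀ : ℂ) r, ℂ) => k ⟨z, Metric.ball_subset_closedBall hz⟩) hg
  have hgev : ∀ z ∈ Metric.ball (z₀ : ℂ) r, g =ᶠ[𝓝 z] G := fun z hz =>
    (Metric.isOpen_ball.eventually_mem hz).mono hgG
  have hline : ∀ z ∈ Metric.ball (z₀ : ℂ) r, ∀ v : ℂ,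
      (fun t : ℝ => g (z + t * v)) =ᶠ[𝓝 0] fun t : ℝ => G (z + t * v) := fun z hz v => by
    have hcont : Continuous fun t : ℝ => z + t * v := by fun_prop
    have ht : Tendsto (fun t : ℝ => z + t * v) (𝓝 0) (𝓝 z) := by
      simpa using hcont.tendsto 0
    exact ht.eventually (hgev z hz)
  have hmemF : ∀ z ∈ Vᶜ ∩ Metric.ball (z₀ : ℂ) r, z ∈ F := fun z hz =>
    ⟨hBD (Metric.ball_subset_closedBall hz.2), hz.1⟩
  have hsmall : ∀ z ∈ Metric.ball (z₀ : ℂ) r, ∀ y ∈ Metric.ball (z₀ : ℂ) r,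
      ‖y - z‖ ≤ 1 / ((n : ℝ) + 1) := fun z hz y hy => by
    rw [← dist_eq_norm]
    have := dist_triangle_right y z z₀
    rw [Metric.mem_ball] at hz hy
    linarith
  have hlip : ∀ v : ℂ, ‖v‖ = 1 → (∀ z : F, (z : ℂ) ∈ Metric.ball (z₀ : ℂ) r → z ∈ E v n) →
      ∀ z ∈ Vᶜ ∩ Metric.ball (z₀ : ℂ) r, ∀ t : ℝ, z + t * v ∈ Metric.ball (z₀ : ℂ) r →
      ‖g (z + t * v) - g z‖ ≤ (n + 1 : ℝ≥0) * |t| := fun v hv hvE z hz t ht => by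
    rw [hgG _ ht, hgG _ hz.2]
    have h := hsmall z hz.2 _ ht
    rw [add_sub_cancel_left, norm_mul, hv, mul_one, norm_real, Real.norm_eq_abs] at h
    simpa using hvE ⟨z, hmemF z hz⟩ hz.2 t h (hBD (Metric.ball_subset_closedBall ht))
  have hE : ∀ z : F, (z : ℂ) ∈ Metric.ball (z₀ : ℂ) r → z ∈ E 1 n ∩ E I n := fun z hz =>
    hεE (lt_trans (show dist z z₀ < r from hz) hrε)
  have hgd : DifferentiableOn ℂ g (Metric.ball (z₀ : ℂ) r) := by
    refine differentiableOn_ball_of_lipschitz_of_differentiableAt g.continuous hVo.isClosed_compl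
      (N := n + 1) (c := c) (fun z hz => ?_) (fun z hz => ?_) ?_ ?_ ?_
    · simpa using (hc₁' z (hFD (hmemF z hz))).congr_of_eventuallyEq (hline z hz.2 1)
    · exact (hc₂ z (hFD (hmemF z hz))).congr_of_eventuallyEq (hline z hz.2 I)
    · simpa using hlip 1 norm_one fun z hz => (hE z hz).1
    · exact hlip I norm_I fun z hz => (hE z hz).2
    · intro z hz hzV
      have hzV' : z ∈ V := not_notMem.1 hzV
      exact (show ∀ᶠ y in 𝓝 z, DifferentiableAt ℂ G y from hzV').self_of_nhds.congr_of_eventuallyEq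
        (hgev z hz)
  refine z₀.2.2 (show ∀ᶠ y in 𝓝 (z₀ : ℂ), DifferentiableAt ℂ G y from ?_)
  filter_upwards [Metric.ball_mem_nhds (z₀ : ℂ) hr] with y hy
  exact (hgd.differentiableAt (Metric.isOpen_ball.mem_nhds hy)).congr_of_eventuallyEq
    (hgev y hy).symm

end LoomanMenchoff

/-! ### Characters attached to minimal steps between ideals. -/

namespace MonogenicExtension

section Algebra

variable {A : Type*} [CommRing A] [Algebra ℂ A] [FiniteDimensional ℂ A]

/-- The simple module `J / J'` is `A / I` for a maximal ideal `I`, and `A / I = ℂ` since `ℂ` is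
algebraically closed. The functional `φ` is the quotient map of `J`, extended to `A` arbitrarily. -/
theorem exists_character_of_covBy {J' J : Ideal A} (hJ : J' ⋖ J) :
    ∃ (f : A →ₐ[ℂ] ℂ) (φ : A →ₗ[ℂ] ℂ), (∀ a, ∀ x ∈ J, φ (a * x) = f a * φ x) ∧
      (∀ x ∈ J, φ x = 0 → x ∈ J') ∧ ∃ x ∈ J, φ x = 1 := by
  obtain ⟨I, hI, ⟨ψ⟩⟩ :=
    isSimpleModule_iff_quot_maximal.1 ((covBy_iff_quot_is_simple hJ.le).1 hJ)
  have : IsDomain (A ⧸ I) := Ideal.Quotient.isDomain I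
  let ε : ℂ ≃ₐ[ℂ] A ⧸ I := AlgEquiv.ofBijective (Algebra.ofId ℂ (A ⧸ I))
    IsAlgClosed.algebraMap_bijective_of_isIntegral
  let f : A →ₐ[ℂ] ℂ := (ε.symm : (A ⧸ I) →ₐ[ℂ] ℂ).comp (Ideal.Quotient.mkₐ ℂ I)
  let θ : J →ₗ[A] A ⧸ I := ψ.toLinearMap.comp (Submodule.mkQ _)
  have hθ : Function.Surjective θ := ψ.surjective.comp (Submodule.mkQ_surjective _)
  let φ₀ : J.restrictScalars ℂ →ₗ[ℂ] ℂ :=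
    { toFun := fun x => ε.symm (θ x)
      map_add' := fun x y => by
        rw [← map_add]; exact congrArg ε.symm (map_add θ x y)
      map_smul' := fun c x => by
        rw [RingHom.id_apply, ← map_smul]
        refine congrArg ε.symm ?_
        exact (congrArg θ (Subtype.ext (algebraMap_smul A c (x : A)).symm)).trans
          ((map_smul θ (algebraMap ℂ A c) ⟨x.1, x.2⟩).trans (algebraMap_smul A c _)) }
  obtain ⟨φ, hφ⟩ := φ₀.exists_extend
  have hφJ : ∀ x (hx : x ∈ J), φ x = ε.symm (θ ⟨x, hx⟩) := fun x hx =>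
    congrArg (fun k : J.restrictScalars ℂ →ₗ[ℂ] ℂ => k ⟨x, hx⟩) hφ
  refine ⟨f, φ, fun a x hx => ?_, fun x hx h0 => ?_, ?_⟩
  · rw [hφJ _ (J.mul_mem_left a hx), hφJ x hx]
    have h1 : θ ⟨a * x, J.mul_mem_left a hx⟩ = a • θ ⟨x, hx⟩ := map_smul θ a ⟨x, hx⟩
    rw [h1, Algebra.smul_def, map_mul]
    rfl
  · rw [hφJ x hx, map_eq_zero_iff _ ε.symm.injective] at h0
    have h1 := (map_eq_zero_iff _ ψ.injective).1 h0
    exact (Submodule.Quotient.mk_eq_zero (Submodule.comap (Submodule.subtype J) J')).1 h1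
  · obtain ⟨⟨x, hx⟩, h1⟩ := hθ (ε 1)
    exact ⟨x, hx, by rw [hφJ x hx, h1, ε.symm_apply_apply]⟩

/-- The powers of `ker f` stabilize at an idempotent ideal, which is generated by an idempotent
`e₀`. Then `e = 1 - e₀` is the unit of the local factor belonging to `f`. -/
theorem exists_annihilated_by_ker_pow (f : A →ₐ[ℂ] ℂ) :
    ∃ (e : A) (M : ℕ), f e = 1 ∧ ∀ x ∈ RingHom.ker f ^ (M + 1), x * e = 0 := by
  have : IsArtinianRing A := IsArtinianRing.of_finite ℂ A
  have : IsNoetherianRing A := IsNoetherianRing.of_finite ℂ A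
  set I : Ideal A := RingHom.ker f
  obtain ⟨n, hn⟩ := IsArtinian.monotone_stabilizes
    (⟨fun k => OrderDual.toDual (I ^ k), fun _ _ h => Ideal.pow_le_pow_right h⟩ :
      ℕ →o (Submodule A A)ᵒᵈ)
  have hst : ∀ m, n ≤ m → I ^ n = I ^ m := fun m hm => OrderDual.toDual.injective (hn m hm)
  have hid : IsIdempotentElem (I ^ (n + 1)) := by
    rw [IsIdempotentElem, ← pow_add, ← hst _ (Nat.le_succ n), ← hst _ (by omega)]
  obtain ⟨e₀, he₀, hspan⟩ :=
    (Ideal.isIdempotentElem_iff_of_fg _ (IsNoetherian.noetherian _)).1 hid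
  have he₀I : f e₀ = 0 := by
    have h1 : e₀ ∈ I ^ (n + 1) := hspan ▸ Submodule.mem_span_singleton_self e₀
    exact (RingHom.mem_ker).1 (Ideal.pow_le_self (Nat.succ_ne_zero n) h1)
  refine ⟨1 - e₀, n, by simp [he₀I], fun x hx => ?_⟩
  rw [hspan] at hx
  obtain ⟨y, rfl⟩ := Submodule.mem_span_singleton.1 hx
  rw [smul_eq_mul, mul_assoc, mul_sub, mul_one, he₀.eq, sub_self, mul_zero]

end Algebra

/-! ### Calculus of one-sided derivatives of curves in a topological algebra. -/

section Curves

variable {B : Type*} [CommRing B] [Algebra ℝ B] [TopologicalSpace B]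

/-- The curve `γ` has the one-sided derivative `d` at `0`. -/
def HasRightDeriv (γ : ℝ → B) (d : B) : Prop :=
  Tendsto (fun ε : ℝ => ε⁻¹ • (γ ε - γ 0)) (𝓝[>] 0) (𝓝 d)

theorem HasRightDeriv.const (b : B) : HasRightDeriv (fun _ => b) 0 := by
  simp [HasRightDeriv, tendsto_const_nhds]

theorem HasRightDeriv.smul_const (b : B) : HasRightDeriv (fun ε : ℝ => ε • b) b := by
  refine tendsto_const_nhds.congr' ?_
  filter_upwards [self_mem_nhdsWithin] with ε hε
  rw [zero_smul, sub_zero, inv_smul_smul₀ (ne_of_gt hε)]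

variable [IsTopologicalRing B]

theorem HasRightDeriv.add {γ₁ γ₂ : ℝ → B} {d₁ d₂ : B} (h₁ : HasRightDeriv γ₁ d₁)
    (h₂ : HasRightDeriv γ₂ d₂) : HasRightDeriv (fun ε => γ₁ ε + γ₂ ε) (d₁ + d₂) :=
  (Tendsto.add h₁ h₂).congr fun ε => by rw [← smul_add]; congr 1; ring

theorem HasRightDeriv.sum {ι : Type*} (s : Finset ι) {γ : ι → ℝ → B} {d : ι → B}
    (h : ∀ i ∈ s, HasRightDeriv (γ i) (d i)) :
    HasRightDeriv (fun ε => ∑ i ∈ s, γ i ε) (∑ i ∈ s, d i) :=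
  (tendsto_finsetSum s h).congr fun ε => by rw [← Finset.smul_sum, Finset.sum_sub_distrib]

variable [ContinuousSMul ℝ B]

theorem HasRightDeriv.tendsto {γ : ℝ → B} {d : B} (h : HasRightDeriv γ d) :
    Tendsto γ (𝓝[>] 0) (𝓝 (γ 0)) := by
  have h1 : Tendsto (fun ε : ℝ => ε) (𝓝[>] 0) (𝓝 0) := nhdsWithin_le_nhds
  have h2 := (h1.smul h).add_const (γ 0)
  rw [zero_smul, zero_add] at h2
  refine h2.congr' ?_
  filter_upwards [self_mem_nhdsWithin] with ε hε
  rw [smul_inv_smul₀ (ne_of_gt hε), sub_add_cancel]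

theorem HasRightDeriv.mul {γ₁ γ₂ : ℝ → B} {d₁ d₂ : B} (h₁ : HasRightDeriv γ₁ d₁)
    (h₂ : HasRightDeriv γ₂ d₂) :
    HasRightDeriv (fun ε => γ₁ ε * γ₂ ε) (d₁ * γ₂ 0 + γ₁ 0 * d₂) := by
  refine ((Tendsto.mul h₁ h₂.tendsto).add (Tendsto.const_mul (γ₁ 0) h₂)).congr fun ε => ?_
  rw [smul_mul_assoc, mul_smul_comm, ← smul_add]
  congr 1
  ring

/-- At `k = 0` the truncated exponent `k - 1` is harmless, because the factor `k` vanishes. -/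
theorem HasRightDeriv.pow {γ : ℝ → B} {d : B} (h : HasRightDeriv γ d) (k : ℕ) :
    HasRightDeriv (fun ε => γ ε ^ k) (k * γ 0 ^ (k - 1) * d) := by
  induction k with
  | zero => simpa using HasRightDeriv.const (1 : B)
  | succ k ih =>
    simp only [pow_succ]
    refine (congrArg (HasRightDeriv _) ?_).mp (ih.mul h)
    rcases k with _ | k
    · simp
    · push_cast
      ring

end Curves

end MonogenicExtension

/-! ### Descent to a holomorphic function of one variable. -/

namespace MonogenicExtension

/-- A function with linear directional derivatives which vanish along the kernel of `L` descends to
a holomorphic function, provided its domain is convex in the direction of this kernel. -/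
theorem exists_holomorphic_descent {E : Type*} [NormedAddCommGroup E] [NormedSpace ℝ E]
    [FiniteDimensional ℝ E] {L : E →ₗ[ℝ] ℂ} (hL : Function.Surjective L) {Ω : Set E}
    (hΩ : IsOpen Ω) (hconv : ∀ p ∈ Ω, ∀ q ∈ Ω, L p = L q → segment ℝ p q ⊆ Ω) {g : E → ℂ}
    (hg : ContinuousOn g Ω)
    (hd : ∀ p ∈ Ω, ∃ c : ℂ, ∀ v, HasDerivAt (fun t : ℝ => g (p + t • v)) (L v * c) 0) :
    ∃ G : ℂ → ℂ, DifferentiableOn ℂ G (L '' Ω) ∧ ∀ p ∈ Ω, G (L p) = g p := by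
  have hLc : Continuous L := L.continuous_of_finiteDimensional
  -- On the segment between two points of a fibre the derivative is `L (q - p) * c = 0`.
  have hfiber : ∀ p ∈ Ω, ∀ q ∈ Ω, L p = L q → g q = g p := by
    intro p hp q hq hpq
    have hseg : ∀ t ∈ Icc (0 : ℝ) 1, p + t • (q - p) ∈ Ω := fun t ht =>
      hconv p hp q hq hpq (by rw [segment_eq_image']; exact ⟨t, ht, rfl⟩)
    have hder : ∀ t ∈ Icc (0 : ℝ) 1, HasDerivAt (fun s : ℝ => g (p + s • (q - p))) 0 t := by
      intro t ht
      obtain ⟨c, hc⟩ := hd _ (hseg t ht)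
      have h1 := hc (q - p)
      rw [map_sub, hpq, sub_self, zero_mul, ← sub_self t] at h1
      refine (HasDerivAt.comp_sub_const (f := fun s : ℝ => g (p + t • (q - p) + s • (q - p)))
        t t h1).congr_of_eventuallyEq (Eventually.of_forall fun s => ?_)
      change g _ = g _
      rw [add_assoc, ← add_smul, add_sub_cancel]
    have := constant_of_has_deriv_right_zero
      (fun t ht => (hder t ht).continuousAt.continuousWithinAt)
      (fun t ht => (hder t (Ico_subset_Icc_self ht)).hasDerivWithinAt) 1 (by simp)
    simpa using this
  -- A linear section of `L` expresses `G` near `L p` through `g` on a plane through `p`, so `G`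
  -- inherits continuity and directional derivatives.
  obtain ⟨s, hs⟩ := L.exists_rightInverse_of_surjective (LinearMap.range_eq_top.2 hL)
  have hLs : ∀ w, L (s w) = w := fun w => congrArg (fun k : ℂ →ₗ[ℝ] ℂ => k w) hs
  have hsc : Continuous s := s.continuous_of_finiteDimensional
  set G : ℂ → ℂ := fun w => g (Function.invFunOn L Ω w)
  have hG : ∀ p ∈ Ω, G (L p) = g p := fun p hp =>
    hfiber p hp _ (Function.invFunOn_mem ⟨p, hp, rfl⟩) (Function.invFunOn_eq ⟨p, hp, rfl⟩).symm
  have hloc : ∀ p ∈ Ω, G =ᶠ[𝓝 (L p)] fun w => g (p + s (w - L p)) := by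
    intro p hp
    have h1 : ContinuousAt (fun w => p + s (w - L p)) (L p) := by fun_prop
    have h2 : ∀ᶠ w in 𝓝 (L p), p + s (w - L p) ∈ Ω :=
      h1.eventually_mem (hΩ.mem_nhds (by simpa using hp))
    filter_upwards [h2] with w hw
    rw [← hG _ hw, map_add, hLs, add_sub_cancel]
  refine ⟨G, LoomanMenchoff.differentiableOn_of_hasDerivAt_lines ?_ ?_ ?_, hG⟩
  · exact L.isOpenMap_of_finiteDimensional hL _ hΩ
  · rintro _ ⟨p, hp, rfl⟩
    refine ContinuousAt.continuousWithinAt (ContinuousAt.congr ?_ (hloc p hp).symm)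
    refine ContinuousAt.comp (g := g) ?_ (by fun_prop)
    simpa using hg.continuousAt (hΩ.mem_nhds hp)
  · rintro _ ⟨p, hp, rfl⟩
    obtain ⟨c, hc⟩ := hd p hp
    have hline : ∀ v : ℂ, HasDerivAt (fun t : ℝ => G (L p + t * v)) (v * c) 0 := by
      intro v
      have h1 := hc (s v)
      rw [hLs] at h1
      refine h1.congr_of_eventuallyEq ?_
      have hcont : Continuous fun t : ℝ => L p + t * v := by fun_prop
      have ht : Tendsto (fun t : ℝ => L p + t * v) (𝓝 0) (𝓝 (L p)) := by
        simpa using hcont.tendsto 0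
      filter_upwards [ht.eventually (hloc p hp)] with t ht
      rw [ht, add_sub_cancel_left, ← Complex.real_smul, map_smul]
    exact ⟨c, by simpa using hline 1, hline Complex.I⟩

/-! ### Monogenic functions and the Taylor sums that extend them. -/

section Topology

variable {A : Type*} [CommRing A] [Algebra ℂ A] [TopologicalSpace A]

theorem continuousSMul_real [ContinuousSMul ℂ A] : ContinuousSMul ℝ A :=
  ⟨by
    have : Continuous fun p : ℝ × A => (p.1 : ℂ) • p.2 := by fun_prop
    simpa only [Complex.coe_smul] using this⟩

/-- A finite-dimensional Hausdorff topology is the module topology, for which multiplication is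
continuous. -/
theorem isTopologicalRing_of_finiteDimensional [FiniteDimensional ℂ A] [IsTopologicalAddGroup A]
    [ContinuousSMul ℂ A] [T2Space A] : IsTopologicalRing A := by
  have : IsModuleTopology ℂ A := IsModuleTopology.iso
    (ContinuousLinearEquiv.ofFinrankEq (by simp) : (Fin (Module.finrank ℂ A) → ℂ) ≃L[ℂ] A)
  exact IsModuleTopology.isTopologicalRing ℂ A

variable {e₂ e₃ : A}

theorem hasGateauxDerivAt_iff {Φ : A → A} {d ζ : A} : HasGateauxDerivAt e₂ e₃ Φ d ζ ↔
    ∀ h ∈ E3 e₂ e₃, HasRightDeriv (fun ε : ℝ => Φ (ζ + ε • h)) (h * d) := by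
  simp only [HasGateauxDerivAt, HasRightDeriv, zero_smul, add_zero]

theorem MonogenicOn.mono {Φ : A → A} {S T : Set A} (h : MonogenicOn e₂ e₃ Φ T) (hST : S ⊆ T) :
    MonogenicOn e₂ e₃ Φ S :=
  ⟨h.1.mono hST, fun ζ hζ => h.2 ζ (hST hζ)⟩

theorem monogenicOn_zero (S : Set A) : MonogenicOn e₂ e₃ (fun _ => 0) S :=
  ⟨continuousOn_const, fun ζ _ => ⟨0, fun h _ => by simp [tendsto_const_nhds]⟩⟩

theorem MonogenicOn.add [IsTopologicalRing A] {Φ Ψ : A → A} {S : Set A}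
    (hΦ : MonogenicOn e₂ e₃ Φ S) (hΨ : MonogenicOn e₂ e₃ Ψ S) :
    MonogenicOn e₂ e₃ (fun ζ => Φ ζ + Ψ ζ) S := by
  refine ⟨hΦ.1.add hΨ.1, fun ζ hζ => ?_⟩
  obtain ⟨d, hd⟩ := hΦ.2 ζ hζ
  obtain ⟨d', hd'⟩ := hΨ.2 ζ hζ
  refine ⟨d + d', hasGateauxDerivAt_iff.2 fun h hh => ?_⟩
  rw [mul_add]
  exact (hasGateauxDerivAt_iff.1 hd h hh).add (hasGateauxDerivAt_iff.1 hd' h hh)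

theorem MonogenicOn.neg [IsTopologicalRing A] {Φ : A → A} {S : Set A}
    (hΦ : MonogenicOn e₂ e₃ Φ S) : MonogenicOn e₂ e₃ (fun ζ => -Φ ζ) S := by
  refine ⟨hΦ.1.neg, fun ζ hζ => ?_⟩
  obtain ⟨d, hd⟩ := hΦ.2 ζ hζ
  refine ⟨-d, fun h hh => ?_⟩
  rw [mul_neg]
  exact (hd h hh).neg.congr fun ε => by rw [← smul_neg, neg_sub_neg, neg_sub]

/-- The function `ζ ↦ G(ζ) b` of an element of the algebra, where `b` is annihilated by the power
`M + 1` of the kernel of `f`, so that only the Taylor polynomial of `G` at `f ζ` matters. -/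
noncomputable def principalExtension (f : A →ₐ[ℂ] ℂ) (G : ℂ → ℂ) (M : ℕ) (b ζ : A) : A :=
  ∑ k ∈ Finset.range (M + 1), algebraMap ℂ A (deriv^[k] G (f ζ) / (k.factorial : ℂ)) *
    (ζ - algebraMap ℂ A (f ζ)) ^ k * b

omit [TopologicalSpace A] in
theorem principalExtension_mem (f : A →ₐ[ℂ] ℂ) (G : ℂ → ℂ) (M : ℕ) {b : A} {J : Ideal A}
    (hb : b ∈ J) (ζ : A) : principalExtension f G M b ζ ∈ J :=
  sum_mem fun _ _ => J.mul_mem_left _ hb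

omit [TopologicalSpace A] in
theorem map_principalExtension {f : A →ₐ[ℂ] ℂ} {φ : A →ₗ[ℂ] ℂ} {J : Ideal A}
    (hφ : ∀ a, ∀ x ∈ J, φ (a * x) = f a * φ x) (G : ℂ → ℂ) (M : ℕ) {b : A} (hb : b ∈ J)
    (hb1 : φ b = 1) (ζ : A) : φ (principalExtension f G M b ζ) = G (f ζ) := by
  rw [principalExtension, map_sum, Finset.sum_eq_single 0]
  · simp [hφ _ b hb, hb1]
  · intro k _ hk
    simp [hφ _ b hb, hk]
  · simp

/-- In the direction `h = f h + m`, with `m ∈ ker f`, the coefficients contribute the factor `f h`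
and the powers of `ζ - f ζ` the factor `m`. After a shift of index the two sums combine to `h` times
the same Taylor sum for `G'`. -/
theorem monogenicOn_principalExtension [FiniteDimensional ℂ A] [IsTopologicalAddGroup A]
    [ContinuousSMul ℂ A] [T2Space A] {f : A →ₐ[ℂ] ℂ} {G : ℂ → ℂ} {D : Set ℂ} (hD : IsOpen D)
    (hG : DifferentiableOn ℂ G D) {M : ℕ} {b : A}
    (hb : ∀ x ∈ RingHom.ker f ^ (M + 1), x * b = 0) {S : Set A} (hS : ∀ ζ ∈ S, f ζ ∈ D) :
    MonogenicOn e₂ e₃ (principalExtension f G M b) S := by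
  have : IsTopologicalRing A := isTopologicalRing_of_finiteDimensional
  have : ContinuousSMul ℝ A := continuousSMul_real
  have hfc : Continuous f := f.toLinearMap.continuous_of_finiteDimensional
  have hac : Continuous (algebraMap ℂ A) :=
    (Algebra.linearMap ℂ A).continuous_of_finiteDimensional
  have hdiff : ∀ k, DifferentiableOn ℂ (deriv^[k] G) D := fun k =>
    ((hG.analyticOnNhd hD).iterated_deriv k).differentiableOn
  refine ⟨?_, fun ζ hζ => ?_⟩
  · refine continuousOn_finsetSum _ fun k _ => ContinuousOn.mul (ContinuousOn.mul
      (hac.comp_continuousOn ?_) (by fun_prop)) continuousOn_const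
    exact ((hdiff k).continuousOn.comp hfc.continuousOn hS).div_const _
  set n : A := ζ - algebraMap ℂ A (f ζ) with hn
  have hnker : n ∈ RingHom.ker f := by simp [RingHom.mem_ker, hn]
  refine ⟨∑ k ∈ Finset.range (M + 1),
    algebraMap ℂ A (deriv^[k + 1] G (f ζ) / (k.factorial : ℂ)) * n ^ k * b,
    hasGateauxDerivAt_iff.2 fun h _ => ?_⟩
  set m : A := h - algebraMap ℂ A (f h) with hm
  have hmker : m ∈ RingHom.ker f := by simp [RingHom.mem_ker, hm]
  have hfε : ∀ ε : ℝ, f (ζ + ε • h) = f ζ + ε * f h := fun ε => by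
    rw [map_add, ← Complex.coe_smul, map_smul, smul_eq_mul]
  have hnil : ∀ ε : ℝ, ζ + ε • h - algebraMap ℂ A (f (ζ + ε • h)) = n + ε • m := fun ε => by
    rw [hfε, hn, hm, smul_sub, map_add, map_mul, ← Complex.coe_smul ε (algebraMap ℂ A (f h)),
      Algebra.smul_def (ε : ℂ) (algebraMap ℂ A (f h))]
    abel
  have hcoef : ∀ k, HasRightDeriv
      (fun ε : ℝ => algebraMap ℂ A (deriv^[k] G (f (ζ + ε • h)) / (k.factorial : ℂ)))
      (algebraMap ℂ A (deriv^[k + 1] G (f ζ) * f h / (k.factorial : ℂ))) := by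
    intro k
    have h1 : HasDerivAt (deriv^[k] G) (deriv^[k + 1] G (f ζ)) (f ζ + (0 : ℝ) * f h) := by
      rw [Complex.ofReal_zero, zero_mul, add_zero, Function.iterate_succ_apply']
      exact ((hdiff k).differentiableAt (hD.mem_nhds (hS ζ hζ))).hasDerivAt
    have h2 : HasDerivAt (fun ε : ℝ => f ζ + ε * f h) (f h) 0 := by
      simpa using ((Complex.ofRealCLM.hasDerivAt (x := (0 : ℝ))).mul_const (f h)).const_add (f ζ)
    have h3 := ((h1.comp (0 : ℝ) h2).div_const (k.factorial : ℂ)).tendsto_slope_zero_right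
    refine ((hac.tendsto _).comp h3).congr fun ε => ?_
    simp only [Function.comp_apply, zero_add, hfε]
    rw [← map_sub, ← Complex.coe_smul, ← Complex.coe_smul, smul_eq_mul, map_mul,
      Algebra.smul_def]
  have hterm : ∀ k ∈ Finset.range (M + 1), HasRightDeriv
      (fun ε : ℝ => algebraMap ℂ A (deriv^[k] G (f (ζ + ε • h)) / (k.factorial : ℂ)) *
        (ζ + ε • h - algebraMap ℂ A (f (ζ + ε • h))) ^ k * b)
      (algebraMap ℂ A (deriv^[k + 1] G (f ζ) * f h / (k.factorial : ℂ)) * n ^ k * b +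
        algebraMap ℂ A (deriv^[k] G (f ζ) / (k.factorial : ℂ)) * (k * n ^ (k - 1) * m) * b) := by
    intro k _
    have h1 : HasRightDeriv (fun ε : ℝ => n + ε • m) m := by
      simpa using (HasRightDeriv.const n).add (HasRightDeriv.smul_const m)
    have h2 := ((hcoef k).mul (h1.pow k)).mul (HasRightDeriv.const b)
    simp only [hnil]
    refine (congrArg (HasRightDeriv _) ?_).mp h2
    simp only [zero_smul, add_zero]
    ring
  refine (congrArg (HasRightDeriv _) ?_).mp (HasRightDeriv.sum _ hterm)
  -- The shift of index leaves one unmatched term, of degree `M + 1` in `ker f`; it is killed by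
  -- `b`.
  have htop : n ^ M * m * b = 0 := by
    refine hb _ ?_
    rw [pow_succ]
    exact Ideal.mul_mem_mul (Ideal.pow_mem_pow hnker M) hmker
  have hshift : ∑ k ∈ Finset.range (M + 1),
        algebraMap ℂ A (deriv^[k] G (f ζ) / (k.factorial : ℂ)) * (k * n ^ (k - 1) * m) * b =
      ∑ k ∈ Finset.range (M + 1),
        m * (algebraMap ℂ A (deriv^[k + 1] G (f ζ) / (k.factorial : ℂ)) * n ^ k * b) := by
    rw [Finset.sum_range_succ', Finset.sum_range_succ]
    congr 1
    · refine Finset.sum_congr rfl fun k _ => ?_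
      have hk : algebraMap ℂ A (deriv^[k + 1] G (f ζ) / ((k + 1).factorial : ℂ)) *
          ((k + 1 : ℕ) : A) = algebraMap ℂ A (deriv^[k + 1] G (f ζ) / (k.factorial : ℂ)) := by
        rw [← map_natCast (algebraMap ℂ A), ← map_mul, Nat.factorial_succ]
        congr 1
        have h1 : (k.factorial : ℂ) ≠ 0 := Nat.cast_ne_zero.2 (Nat.factorial_ne_zero k)
        have h2 : ((k + 1 : ℕ) : ℂ) ≠ 0 := Nat.cast_ne_zero.2 (Nat.succ_ne_zero k)
        rw [Nat.cast_mul]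
        field_simp
      rw [← hk, Nat.add_sub_cancel]
      ring
    · rw [show m * (algebraMap ℂ A (deriv^[M + 1] G (f ζ) / (M.factorial : ℂ)) * n ^ M * b) =
        algebraMap ℂ A (deriv^[M + 1] G (f ζ) / (M.factorial : ℂ)) * (n ^ M * m * b) by ring, htop]
      simp
  rw [Finset.sum_add_distrib, hshift, Finset.mul_sum, ← Finset.sum_add_distrib]
  refine Finset.sum_congr rfl fun k _ => ?_
  rw [mul_div_right_comm, map_mul, hm]
  ring

end Topology

end MonogenicExtension

/-! ### Passage between `ℝ³` and `E₃`, and the induction on ideals. -/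

namespace MonogenicExtension

variable {A : Type*} [CommRing A] [Algebra ℂ A]

/-- The linear parametrization of `E₃`. -/
def pointₗ (e₂ e₃ : A) : EuclideanSpace ℝ (Fin 3) →ₗ[ℝ] A where
  toFun := point e₂ e₃
  map_add' p q := by simp only [point, PiLp.add_apply, add_smul]; abel
  map_smul' r p := by simp [point, smul_add, mul_smul]

theorem point_mem_E3 (e₂ e₃ : A) (p : EuclideanSpace ℝ (Fin 3)) : point e₂ e₃ p ∈ E3 e₂ e₃ :=
  add_mem (add_mem (Submodule.smul_mem _ _ (Submodule.subset_span (by simp)))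
    (Submodule.smul_mem _ _ (Submodule.subset_span (by simp))))
    (Submodule.smul_mem _ _ (Submodule.subset_span (by simp)))

theorem exists_point_eq {e₂ e₃ h : A} (hh : h ∈ E3 e₂ e₃) :
    ∃ p : EuclideanSpace ℝ (Fin 3), point e₂ e₃ p = h := by
  obtain ⟨a, b, c, rfl⟩ := Submodule.mem_span_triple.1 hh
  exact ⟨!₂[a, b, c], by simp [point]⟩

/-- The composition of a multiplicative functional with the parametrization of `E₃`. -/
noncomputable def functionalₗ (e₂ e₃ : A) (f : A →ₐ[ℂ] ℂ) : EuclideanSpace ℝ (Fin 3) →ₗ[ℝ] ℂ :=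
  (f.toLinearMap.restrictScalars ℝ).comp (pointₗ e₂ e₃)

theorem functionalₗ_apply (e₂ e₃ : A) (f : A →ₐ[ℂ] ℂ) (p : EuclideanSpace ℝ (Fin 3)) :
    functionalₗ e₂ e₃ f p = f (point e₂ e₃ p) := rfl

theorem mem_line_iff {e₂ e₃ : A} {f : A →ₐ[ℂ] ℂ} {p : EuclideanSpace ℝ (Fin 3)} :
    p ∈ line e₂ e₃ f ↔ functionalₗ e₂ e₃ f p = 0 := by
  have h : functionalₗ e₂ e₃ f p = p 0 + p 1 * f e₂ + p 2 * f e₃ := by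
    rw [functionalₗ_apply, point]
    simp only [map_add, ← Complex.coe_smul, map_smul, map_one, smul_eq_mul, mul_one]
  rw [h, Complex.ext_iff]
  simp [line]

theorem functionalₗ_surjective {e₂ e₃ : A} {f : A →ₐ[ℂ] ℂ}
    (hf : f '' (E3 e₂ e₃ : Set A) = Set.univ) : Function.Surjective (functionalₗ e₂ e₃ f) := by
  intro w
  obtain ⟨h, hh, rfl⟩ := hf.superset (mem_univ w)
  obtain ⟨p, rfl⟩ := exists_point_eq hh
  exact ⟨p, rfl⟩

theorem image_domainImage (e₂ e₃ : A) (f : A →ₐ[ℂ] ℂ) (Ω : Set (EuclideanSpace ℝ (Fin 3))) :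
    f '' domainImage e₂ e₃ Ω = functionalₗ e₂ e₃ f '' Ω := by
  rw [domainImage, image_image]; rfl

theorem isOpen_image_domainImage {e₂ e₃ : A} {f : A →ₐ[ℂ] ℂ}
    (hf : f '' (E3 e₂ e₃ : Set A) = Set.univ) {Ω : Set (EuclideanSpace ℝ (Fin 3))}
    (hΩ : IsOpen Ω) : IsOpen (f '' domainImage e₂ e₃ Ω) := by
  rw [image_domainImage]
  exact LinearMap.isOpenMap_of_finiteDimensional _ (functionalₗ_surjective hf) _ hΩ

theorem domainImage_subset_extendedDomain (e₂ e₃ : A) (Ω : Set (EuclideanSpace ℝ (Fin 3))) :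
    domainImage e₂ e₃ Ω ⊆ extendedDomain e₂ e₃ Ω := by
  rintro _ ⟨p, hp, rfl⟩
  exact ⟨point_mem_E3 e₂ e₃ p, fun f => mem_image_of_mem f ⟨p, hp, rfl⟩⟩

variable [FiniteDimensional ℂ A] [TopologicalSpace A] [IsTopologicalAddGroup A]
  [ContinuousSMul ℂ A] [T2Space A]

/-- A finite-dimensional algebra has only finitely many characters, so the intersection over them is
finite. -/
theorem isOpen_extendedDomain {e₂ e₃ : A}
    (hsurj : ∀ f : A →ₐ[ℂ] ℂ, f '' (E3 e₂ e₃ : Set A) = Set.univ)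
    {Ω : Set (EuclideanSpace ℝ (Fin 3))} (hΩ : IsOpen Ω) :
    IsOpen ((↑) ⁻¹' extendedDomain e₂ e₃ Ω : Set (E3 e₂ e₃)) := by
  have : ((↑) ⁻¹' extendedDomain e₂ e₃ Ω : Set (E3 e₂ e₃)) =
      ⋂ f : A →ₐ[ℂ] ℂ, (fun ζ : E3 e₂ e₃ => f ζ) ⁻¹' (f '' domainImage e₂ e₃ Ω) := by
    ext ζ
    simp [extendedDomain]
  rw [this]
  refine isOpen_iInter_of_finite fun f => (isOpen_image_domainImage (hsurj f) hΩ).preimage ?_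
  exact f.toLinearMap.continuous_of_finiteDimensional.comp continuous_subtype_val

/-- If a monogenic function takes values in an ideal on which the algebra acts modulo `ker φ` by the
character `f`, then `φ ∘ Φ` is a holomorphic function of `f`. -/
theorem MonogenicOn.exists_holomorphic {e₂ e₃ : A} {Ω : Set (EuclideanSpace ℝ (Fin 3))}
    (hΩ : IsOpen Ω) {f : A →ₐ[ℂ] ℂ} (hf : f '' (E3 e₂ e₃ : Set A) = Set.univ)
    (hconv : ConvexInDirection (line e₂ e₃ f) Ω) {J : Ideal A} {φ : A →ₗ[ℂ] ℂ}
    (hφ : ∀ a, ∀ x ∈ J, φ (a * x) = f a * φ x) {Φ : A → A}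
    (hΦ : MonogenicOn e₂ e₃ Φ (domainImage e₂ e₃ Ω)) (hΦJ : ∀ ζ ∈ domainImage e₂ e₃ Ω, Φ ζ ∈ J) :
    ∃ G : ℂ → ℂ, DifferentiableOn ℂ G (f '' domainImage e₂ e₃ Ω) ∧
      ∀ ζ ∈ domainImage e₂ e₃ Ω, G (f ζ) = φ (Φ ζ) := by
  have : ContinuousSMul ℝ A := continuousSMul_real
  have hφc : Continuous φ := φ.continuous_of_finiteDimensional
  have hpc : Continuous (point e₂ e₃) := (pointₗ e₂ e₃).continuous_of_finiteDimensional
  have hJc : IsClosed (J : Set A) := (J.restrictScalars ℂ).closed_of_finiteDimensional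
  have hadd : ∀ (p v : EuclideanSpace ℝ (Fin 3)) (t : ℝ),
      point e₂ e₃ (p + t • v) = point e₂ e₃ p + t • point e₂ e₃ v := fun p v t => by
    change pointₗ e₂ e₃ _ = pointₗ e₂ e₃ p + t • pointₗ e₂ e₃ v
    rw [map_add, map_smul]
  have hcurve : ∀ p ∈ Ω, ∀ v, ∀ᶠ t : ℝ in 𝓝[>] 0, p + t • v ∈ Ω := fun p hp v => by
    have hc : Continuous fun t : ℝ => p + t • v := by fun_prop
    exact nhdsWithin_le_nhds (hc.continuousAt.eventually_mem (hΩ.mem_nhds (by simpa using hp)))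
  obtain ⟨G, hG, hGe⟩ := exists_holomorphic_descent (functionalₗ_surjective hf) hΩ
    (g := fun p => φ (Φ (point e₂ e₃ p)))
    (fun p hp q hq hpq => hconv p hp q hq (mem_line_iff.2 (by rw [map_sub, hpq, sub_self])))
    (hφc.comp_continuousOn (hΦ.1.comp hpc.continuousOn fun p hp => mem_image_of_mem _ hp))
    (fun p hp => by
      obtain ⟨d, hd⟩ := hΦ.2 _ (mem_image_of_mem (point e₂ e₃) hp)
      -- The difference quotients lie in `J`, which is closed as a finite-dimensional subspace. The
      -- direction `h = 1` then gives `d ∈ J`, so `φ (h * d) = f h * φ d`.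
      have hmem : ∀ v, point e₂ e₃ v * d ∈ J := fun v => by
        refine hJc.mem_of_tendsto (hd _ (point_mem_E3 e₂ e₃ v)) ?_
        filter_upwards [hcurve p hp v] with t ht
        rw [← hadd, ← Complex.coe_smul, ← algebraMap_smul A]
        exact J.mul_mem_left _ (J.sub_mem (hΦJ _ (mem_image_of_mem _ ht))
          (hΦJ _ (mem_image_of_mem _ hp)))
      have hdJ : d ∈ J := by
        obtain ⟨v, hv⟩ := exists_point_eq (e₂ := e₂) (e₃ := e₃) (h := 1)
          (Submodule.subset_span (by simp))
        simpa [hv] using hmem v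
      have hright : ∀ v, Tendsto (fun t : ℝ => t⁻¹ • (φ (Φ (point e₂ e₃ (p + t • v))) -
          φ (Φ (point e₂ e₃ p)))) (𝓝[>] 0) (𝓝 (functionalₗ e₂ e₃ f v * φ d)) := fun v => by
        have h1 := (hφc.tendsto _).comp (hd _ (point_mem_E3 e₂ e₃ v))
        rw [hφ _ d hdJ] at h1
        refine h1.congr fun t => ?_
        rw [Function.comp_apply, ← hadd, ← Complex.coe_smul, map_smul, map_sub, Complex.coe_smul]
      -- The left derivative along `v` comes from the right derivative along `-v`, since the
      -- derivative is linear in the direction.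
      refine ⟨φ d, fun v => hasDerivAt_iff_tendsto_slope_zero.2 ?_⟩
      simp only [zero_add, zero_smul, add_zero]
      rw [← Iio_union_Ioi, nhdsWithin_union, tendsto_sup]
      refine ⟨?_, hright v⟩
      have h0 : Tendsto (fun t : ℝ => -t) (𝓝[<] 0) (𝓝[>] 0) := by
        simpa using tendsto_neg_nhdsLT (a := (0 : ℝ))
      have h2 := ((hright (-v)).neg).comp h0
      rw [map_neg, neg_mul, neg_neg] at h2
      refine h2.congr fun t => ?_
      simp [inv_neg])
  refine ⟨G, by rwa [image_domainImage], ?_⟩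
  rintro _ ⟨p, hp, rfl⟩
  exact hGe p hp

theorem exists_monogenicOn_extendedDomain {e₂ e₃ : A}
    (hsurj : ∀ f : A →ₐ[ℂ] ℂ, f '' (E3 e₂ e₃ : Set A) = Set.univ)
    {Ω : Set (EuclideanSpace ℝ (Fin 3))} (hΩ : IsOpen Ω)
    (hconv : ∀ f : A →ₐ[ℂ] ℂ, ConvexInDirection (line e₂ e₃ f) Ω) (J : Ideal A) :
    ∀ Φ : A → A, MonogenicOn e₂ e₃ Φ (domainImage e₂ e₃ Ω) →
      (∀ ζ ∈ domainImage e₂ e₃ Ω, Φ ζ ∈ J) →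
      ∃ Ψ : A → A, MonogenicOn e₂ e₃ Ψ (extendedDomain e₂ e₃ Ω) ∧
        Set.EqOn Ψ Φ (domainImage e₂ e₃ Ω) := by
  have : IsTopologicalRing A := isTopologicalRing_of_finiteDimensional
  have : IsArtinianRing A := IsArtinianRing.of_finite ℂ A
  have : IsNoetherianRing A := IsNoetherianRing.of_finite ℂ A
  induction J using WellFoundedLT.induction with
  | ind J ih =>
    intro Φ hΦ hΦJ
    by_cases hJ : J = ⊥
    · refine ⟨fun _ => 0, monogenicOn_zero _, fun ζ hζ => ?_⟩
      have := hΦJ ζ hζ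
      rw [hJ, Ideal.mem_bot] at this
      exact this.symm
    obtain ⟨J', -, hJ'⟩ := exists_le_covBy_of_lt (bot_lt_iff_ne_bot.2 hJ)
    obtain ⟨f, φ, hφ, hker, x, hxJ, hx1⟩ := exists_character_of_covBy hJ'
    obtain ⟨e, M, he1, heM⟩ := exists_annihilated_by_ker_pow f
    obtain ⟨G, hG, hGΦ⟩ := hΦ.exists_holomorphic hΩ (hsurj f) (hconv f) hφ hΦJ
    -- The factor `e` makes the coefficient killed by a power of `ker f`; the factor `x` puts it in
    -- `J`. Since `f e = 1` and `φ x = 1`, also `φ (e * x) = 1`.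
    set T := principalExtension f G M (e * x) with hT
    have hbJ : e * x ∈ J := J.mul_mem_left e hxJ
    have hb1 : φ (e * x) = 1 := by rw [hφ _ x hxJ, he1, hx1, one_mul]
    have hTmono : MonogenicOn e₂ e₃ T (extendedDomain e₂ e₃ Ω) :=
      monogenicOn_principalExtension (isOpen_image_domainImage (hsurj f) hΩ) hG
        (fun y hy => by rw [← mul_assoc, heM y hy, zero_mul]) fun ζ hζ => hζ.2 f
    obtain ⟨Ψ, hΨ, hΨΦ⟩ := ih J' hJ'.lt (fun ζ => Φ ζ + -T ζ)
      (hΦ.add (hTmono.mono (domainImage_subset_extendedDomain e₂ e₃ Ω)).neg) fun ζ hζ => by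
        refine hker _ (J.add_mem (hΦJ ζ hζ) (J.neg_mem (principalExtension_mem f G M hbJ ζ))) ?_
        rw [map_add, map_neg, hT, map_principalExtension hφ G M hbJ hb1, hGΦ ζ hζ, add_neg_cancel]
    refine ⟨fun ζ => Ψ ζ + T ζ, hΨ.add hTmono, fun ζ hζ => ?_⟩
    change Ψ ζ + T ζ = Φ ζ
    rw [hΨΦ hζ, neg_add_cancel_right]

end MonogenicExtension

open MonogenicExtension in
theorem theorem2 {A : Type*} [CommRing A] [Algebra ℂ A] [FiniteDimensional ℂ A]
    [TopologicalSpace A] [IsTopologicalAddGroup A] [ContinuousSMul ℂ A] [T2Space A]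
    (e₂ e₃ : A) (he : LinearIndependent ℝ ![1, e₂, e₃])
    (hsurj : ∀ f : A →ₐ[ℂ] ℂ, f '' (E3 e₂ e₃ : Set A) = Set.univ)
    (Ω : Set (EuclideanSpace ℝ (Fin 3))) (hΩ_open : IsOpen Ω) (hΩ_conn : IsConnected Ω)
    (hΩ_convex : ∀ f : A →ₐ[ℂ] ℂ, ConvexInDirection (line e₂ e₃ f) Ω) :
    IsOpen ((↑) ⁻¹' extendedDomain e₂ e₃ Ω : Set (E3 e₂ e₃)) ∧
    domainImage e₂ e₃ Ω ⊆ extendedDomain e₂ e₃ Ω ∧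
    ∀ Φ : A → A, MonogenicOn e₂ e₃ Φ (domainImage e₂ e₃ Ω) →
      ∃ Ψ : A → A, MonogenicOn e₂ e₃ Ψ (extendedDomain e₂ e₃ Ω) ∧
        Set.EqOn Ψ Φ (domainImage e₂ e₃ Ω) :=
  ⟨isOpen_extendedDomain hsurj hΩ_open, domainImage_subset_extendedDomain e₂ e₃ Ω,
    fun Φ hΦ => exists_monogenicOn_extendedDomain hsurj hΩ_open hΩ_convex ⊤ Φ hΦ
      fun _ _ => Submodule.mem_top⟩
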